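/- Let $p$ be a prime and let $F(T)=pT+T^p+pT^2G(T)$, with $G\in\mathbb{Z}_p[[T]]$, be a Lubin–Tate series. Let $(\pi_m)_{m\ge 0}$ be a Tate generator for $F$: elements of the open unit disc of $\mathbb{C}_p$ with $\pi_0\neq 0$, $F(\pi_0)=0$ and $F(\pi_{m+1})=\pi_m$ for all $m$. Let $\mathcal{O}\subset\mathbb{C}_p$ be the $\mathbb{Z}_p$-algebra generated by the zeros in the open unit disc of the compositional powers $F^{\circ(m+1)}$, $m\ge 0$. For a Witt vector $\mathbf{a}=(a_i)_{i\ge0}$ over $\mathbb{C}_p$ put $E(\mathbf{a})=\prod_{i\ge 0}AH(a_ix^{p^i})$, where $AH(x)=\exp\bigl(\sum_{n\ge0}p^{-n}x^{p^n}\bigr)$. Let $\boldsymbol{\varpi}_m$ be the Witt vector over $\mathbb{C}_p$ with ghost components $\pi_m,\pi_{m-1},\dots,\pi_0,0,0,\dots$. Let $\varphi$ be an absolute Frobenius of $\mathbb{C}_p$ (any ring endomorphism of $\mathbb{C}_p$ may be taken here, as only $\mathbf{a}=\mathbf{1}$ is used below), let $\mathbf{a}^\varphi$ be the image of $\mathbf{a}$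 under $\varphi$, and put $$\theta_m(\mathbf{a})(x)=\frac{E(\boldsymbol{\varpi}_m\mathbf{a})(x)}{E(\boldsymbol{\varpi}_m\mathbf{a}^\varphi)(x^p)},\qquad \theta_{m,s}(\mathbf{a})(x)=\prod_{i=0}^{s-1}\theta_m(\mathbf{a}^{\varphi^i})(x^{p^i}).$$ Let $\ell,s\ge1$, $q=p^s$, and let $\mu_{q-1}\subset\mathbb{C}_p$ be the group of $(q-1)$-th roots of unity. Let $\mathbb{F}_q$ be a field with $q$ elements together with a ring morphism (reduction) $\mathbb{Z}_p[\mu_{q-1}]\to\mathbb{F}_q$. For $r\ge1$, let $\mathbb{F}_{q^r}$ be an extension of $\mathbb{F}_q$ of degree $r$ with any reduction morphism $\mathbb{Z}_p[\mu_{q^r-1}]\to\mathbb{F}_{q^r}$ that extends the one of $\mathbb{F}_q$. For $y\in\mathbb{F}_{q^r}$, $\mathrm{Teich}(y)$ is the unique $z\in\mathbb{Z}_p[\mu_{q^r-1}]$ with $z^{q^r}=z$ and reduction $y$. The trace $\mathrm{Tr}:W_\ell(\mathbb{F}_{q^r})\to W_\ell(\mathbb{F}_q)$ is $\mathbf{y}\mapsto\sum_{i=0}^{r-1}W_\ell(\sigma^i)(\mathbf{y})$,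 where $\sigma(y)=y^q$ and $W_\ell$ denotes Witt vectors of length $\ell$. Let $R$ be a subring of $\mathbb{C}_p$. An $s$-splitting function of level $\ell$ with coefficients in $R$ is a formal power series $\Omega(x_0,\dots,x_{\ell-1})$ with coefficients in $R$ that converges on a polydisc $D(0,\rho_0)\times\cdots\times D(0,\rho_{\ell-1})$ with all $\rho_j>1$, and such that: 1. the function $\psi(\mathbf{y})=\Omega(\mathrm{Teich}(y_0),\dots,\mathrm{Teich}(y_{\ell-1}))$ is an additive character of $W_\ell(\mathbb{F}_q)$ with values in $\mathbb{C}_p^*$, of order $p^\ell$; 2. for every $r\ge1$ and every $\mathbf{y}=(y_0,\dots,y_{\ell-1})\in W_\ell(\mathbb{F}_{q^r})$, $$\psi(\mathrm{Tr}(\mathbf{y}))=\prod_{i=0}^{r-1}\Omega\bigl(\mathrm{Teich}(y_0)^{q^i},\dots,\mathrm{Teich}(y_{\ell-1})^{q^i}\bigr).$$ **Theorem.** Let $t\in\mathbb{Z}_p[\mu_{q-1}]$ satisfy $t^q=t$ and $\mathrm{Tr}_{\mathbb{Q}_p(\mu_{q-1})/\mathbb{Q}_p}(t)\notin p\mathbb{Z}_p$.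 Then $$\Omega_{\ell,s,t}(x_0,\dots,x_{\ell-1})=\prod_{j=0}^{\ell-1}\theta_{\ell-j-1,s}(\mathbf{1})(t^{p^j}x_j)$$ is an $s$-splitting function of level $\ell$ with coefficients in $\mathcal{O}[\mu_{q-1}]$. If moreover $t\in\mathbb{Z}_p$, its coefficients lie in $\mathcal{O}$, so that it is an $s$-splitting function of level $\ell$ with coefficients in $\mathcal{O}$. -/

import Mathlib

open scoped PowerSeries

noncomputable section

namespace SplittingFunctions

universe u

/-! ### Truncated Witt vectors: functoriality and trace -/

section WittTrace

variable (p : ℕ) [Fact p.Prime]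

/-- The ring morphism `W_ℓ(f)`, acting on each component by `f`. -/
def truncMap {R S : Type u} [CommRing R] [CommRing S] (ℓ : ℕ) (f : R →+* S) :
    TruncatedWittVector p ℓ R →+* TruncatedWittVector p ℓ S :=
  have key : ∀ x : WittVector p R,
      TruncatedWittVector.mk p (fun i => f ((WittVector.truncate ℓ x).coeff i)) =
        WittVector.truncate ℓ (WittVector.map f x) := by
    intro x
    ext i
    simp [WittVector.map_coeff]
  { toFun := fun x => TruncatedWittVector.mk p fun i => f (x.coeff i)
    map_zero' := by
      have h := key 0
      simpa only [map_zero] using h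
    map_one' := by
      have h := key 1
      simpa only [map_one] using h
    map_add' := by
      intro x y
      obtain ⟨x, rfl⟩ := WittVector.truncate_surjective p ℓ R x
      obtain ⟨y, rfl⟩ := WittVector.truncate_surjective p ℓ R y
      rw [← map_add, key, key, key, map_add, map_add]
    map_mul' := by
      intro x y
      obtain ⟨x, rfl⟩ := WittVector.truncate_surjective p ℓ R x
      obtain ⟨y, rfl⟩ := WittVector.truncate_surjective p ℓ R y
      rw [← map_mul, key, key, key, map_mul, map_mul] }

@[simp]
theorem coeff_truncMap {R S : Type u} [CommRing R] [CommRing S] (ℓ : ℕ) (f : R →+* S)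
    (x : TruncatedWittVector p ℓ R) (i : Fin ℓ) :
    (truncMap p ℓ f x).coeff i = f (x.coeff i) :=
  TruncatedWittVector.coeff_mk _ i

variable (k k' : Type u) [Field k] [Fintype k] [Field k'] [Algebra k k']

theorem exists_of_pow_card_eq {x : k'} (hx : x ^ Fintype.card k = x) :
    ∃ a : k, algebraMap k k' a = x := by
  have h1 : (∏ a : k, (Polynomial.X - Polynomial.C a)) =
      (Polynomial.X ^ Fintype.card k - Polynomial.X : Polynomial k) := by
    have h := Polynomial.prod_multiset_X_sub_C_of_monic_of_roots_card_eq
      (p := (Polynomial.X ^ Fintype.card k - Polynomial.X : Polynomial k)) ?_ ?_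
    · rwa [FiniteField.roots_X_pow_card_sub_X] at h
    · exact Polynomial.monic_X_pow_sub (by
        rw [Polynomial.degree_X]; exact_mod_cast Fintype.one_lt_card)
    · rw [FiniteField.roots_X_pow_card_sub_X,
        FiniteField.X_pow_card_sub_X_natDegree_eq k Fintype.one_lt_card]
      rfl
  have h2 := congrArg (Polynomial.aeval x) h1
  simp only [map_prod, map_sub, map_pow, Polynomial.aeval_X, Polynomial.aeval_C, hx,
    sub_self] at h2
  obtain ⟨a, -, ha⟩ := Finset.prod_eq_zero_iff.mp h2
  exact ⟨a, (sub_eq_zero.mp ha).symm⟩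

/-- The sum of the conjugates of `y ∈ W_ℓ(k')` under the powers `σ ^ i`, `0 ≤ i < [k' : k]`, of
the Frobenius `σ : x ↦ x ^ q`, where `q` is the number of elements of `k`. -/
def conjSum (ℓ : ℕ) (y : TruncatedWittVector p ℓ k') : TruncatedWittVector p ℓ k' :=
  ∑ i ∈ Finset.range (Module.finrank k k'),
    truncMap p ℓ ((FiniteField.frobeniusAlgHom k k' ^ i : k' →ₐ[k] k') : k' →+* k') y

variable [Finite k']

/-- The sum of the conjugates of `y` comes from a unique element of `W_ℓ(k)`. -/
theorem existsUnique_trace (ℓ : ℕ) (y : TruncatedWittVector p ℓ k') :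
    ∃! x : TruncatedWittVector p ℓ k,
      truncMap p ℓ (algebraMap k k') x = conjSum p k k' ℓ y := by
  set σ : k' →ₐ[k] k' := FiniteField.frobeniusAlgHom k k' with hσ
  have hone : σ ^ Module.finrank k k' = 1 := by
    rw [hσ, ← FiniteField.orderOf_frobeniusAlgHom k k']
    exact pow_orderOf_eq_one _
  have hstep : ∀ i : ℕ, truncMap p ℓ (σ : k' →+* k')
      (truncMap p ℓ ((σ ^ i : k' →ₐ[k] k') : k' →+* k') y) =
      truncMap p ℓ ((σ ^ (i + 1) : k' →ₐ[k] k') : k' →+* k') y := by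
    intro i
    ext j
    simp [pow_succ']
  have hfix : truncMap p ℓ (σ : k' →+* k') (conjSum p k k' ℓ y) = conjSum p k k' ℓ y := by
    unfold conjSum
    rw [map_sum, Finset.sum_congr rfl fun i _ => hstep i]
    have h1 := Finset.sum_range_succ
      (fun i => truncMap p ℓ ((σ ^ i : k' →ₐ[k] k') : k' →+* k') y) (Module.finrank k k')
    have h2 := Finset.sum_range_succ'
      (fun i => truncMap p ℓ ((σ ^ i : k' →ₐ[k] k') : k' →+* k') y) (Module.finrank k k')
    rw [h2] at h1
    simp only [hone, pow_zero] at h1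
    exact add_right_cancel h1
  have hcoeff : ∀ j : Fin ℓ, ∃ a : k, algebraMap k k' a = (conjSum p k k' ℓ y).coeff j := by
    intro j
    apply exists_of_pow_card_eq
    conv_rhs => rw [← hfix]
    simp [hσ]
  choose a ha using hcoeff
  refine ⟨TruncatedWittVector.mk p a, ?_, ?_⟩
  · ext j
    simp [ha]
  · intro x hx
    ext j
    apply (algebraMap k k').injective
    rw [TruncatedWittVector.coeff_mk, ha, ← hx, coeff_truncMap]

/-- The trace `W_ℓ(k') → W_ℓ(k)`: the sum of the conjugates, seen in `W_ℓ(k)`. -/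
def wittTrace (ℓ : ℕ) (y : TruncatedWittVector p ℓ k') : TruncatedWittVector p ℓ k :=
  (existsUnique_trace p k k' ℓ y).choose

end WittTrace

variable (p : ℕ) [Fact p.Prime]

/-! ### Subrings and subfields of `ℂ_p` -/

/-- The inclusion of `ℤ_p` in `ℂ_p`. -/
def ofPadicInt : ℤ_[p] →+* ℂ_[p] :=
  (algebraMap ℚ_[p] ℂ_[p]).comp PadicInt.Coe.ringHom

/-- `μ_{q-1}`, where `q = p ^ s`. -/
def rootsMu (s : ℕ) : Set ℂ_[p] := {z | z ^ (p ^ s - 1) = 1}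

/-- The subring `ℤ_p[μ_{q-1}]` of `ℂ_p`, where `q = p ^ s`. -/
def ringMu (s : ℕ) : Subring ℂ_[p] :=
  Subring.closure (Set.range (ofPadicInt p) ∪ rootsMu p s)

/-- The subfield `ℚ_p(μ_{q-1})` of `ℂ_p`, where `q = p ^ s`. -/
def fieldMu (s : ℕ) : IntermediateField ℚ_[p] ℂ_[p] :=
  IntermediateField.adjoin ℚ_[p] (rootsMu p s)

theorem ringMu_le (s r : ℕ) : ringMu p s ≤ ringMu p (s * r) := by
  apply Subring.closure_mono
  apply Set.union_subset_union_right
  intro z hz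
  have hdvd : p ^ s - 1 ∣ p ^ (s * r) - 1 := by
    rw [pow_mul]
    exact Nat.sub_one_dvd_pow_sub_one _ _
  obtain ⟨c, hc⟩ := hdvd
  have hz' : z ^ (p ^ s - 1) = 1 := hz
  change z ^ (p ^ (s * r) - 1) = 1
  rw [hc, pow_mul, hz', one_pow]

/-! ### Lubin-Tate series and Tate generators -/

/-- `F` is a Lubin-Tate series for the uniformizer `p`: `F = p T + T ^ p + p T ^ 2 G(T)`. -/
def IsLubinTate (F : ℤ_[p]⟦X⟧) : Prop :=
  ∃ G : ℤ_[p]⟦X⟧, F = (p : ℤ_[p]⟦X⟧) * PowerSeries.X + PowerSeries.X ^ p +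
    (p : ℤ_[p]⟦X⟧) * PowerSeries.X ^ 2 * G

variable {p}

/-- The value at `z`, `‖z‖ < 1`, of a power series with coefficients in `ℤ_p`. -/
def evalInt (F : ℤ_[p]⟦X⟧) (z : ℂ_[p]) : ℂ_[p] :=
  ∑' n : ℕ, ofPadicInt p (PowerSeries.coeff n F) * z ^ n

/-- The subring `𝒪` of `ℂ_p` generated over `ℤ_p` by the zeros, in the open unit disc, of the
compositional powers `F ∘ ⋯ ∘ F` (with `m + 1` factors, `m ≥ 0`). -/
def ringO (F : ℤ_[p]⟦X⟧) : Subring ℂ_[p] :=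
  Subring.closure (Set.range (ofPadicInt p) ∪
    {z | ‖z‖ < 1 ∧ ∃ m : ℕ, (evalInt F)^[m + 1] z = 0})

/-- `(π_m)` is a Tate generator for `F`. The condition `π_0 ≠ 0` says that `π_m` is a uniformizer
of `ℤ_p[π_m]`. -/
structure IsTateGenerator (F : ℤ_[p]⟦X⟧) (π : ℕ → ℂ_[p]) : Prop where
  norm_lt_one : ∀ m, ‖π m‖ < 1
  zero_ne : π 0 ≠ 0
  eval_zero : evalInt F (π 0) = 0
  eval_succ : ∀ m, evalInt F (π (m + 1)) = π m

/-! ### The Artin-Hasse morphism and the exponentials of Robba and Pulita -/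

variable (p) in
/-- The Artin-Hasse series `exp (∑ n, X ^ (p ^ n) / p ^ n)`. -/
def artinHasse : ℚ⟦X⟧ :=
  open Classical in
  PowerSeries.subst
    (PowerSeries.mk fun d : ℕ => if ∃ n : ℕ, d = p ^ n then ((d : ℚ))⁻¹ else 0 : ℚ⟦X⟧)
    (PowerSeries.exp ℚ)

/-- The series `AH (a X ^ d)` with coefficients in `ℂ_p` (for `d ≥ 1`). -/
def artinHasseAt (a : ℂ_[p]) (d : ℕ) : ℂ_[p]⟦X⟧ :=
  PowerSeries.subst (PowerSeries.C a * PowerSeries.X ^ d : ℂ_[p]⟦X⟧)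
    (PowerSeries.map (Rat.castHom ℂ_[p]) (artinHasse p))

/-- The Artin-Hasse morphism `E(a) = ∏_{i ≥ 0} AH (a_i X ^ (p ^ i))`. The factors with `i > n` are
`1` up to terms of degree `> n`, so the coefficient of `X ^ n` is that of the product over
`i ≤ n`. -/
def artinHasseMap (a : WittVector p ℂ_[p]) : ℂ_[p]⟦X⟧ :=
  PowerSeries.mk fun n : ℕ =>
    PowerSeries.coeff n (∏ i ∈ Finset.range (n + 1), artinHasseAt (a.coeff i) (p ^ i))

/-- The Witt vector `ϖ_m` with ghost components `π_m, π_{m-1}, …, π_0, 0, 0, …`. It is unique, as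
the ghost map of `ℂ_p` is bijective. -/
def varpi (π : ℕ → ℂ_[p]) (m : ℕ) : WittVector p ℂ_[p] :=
  letI : Invertible (p : ℂ_[p]) :=
    invertibleOfNonzero (Nat.cast_ne_zero.mpr (Fact.out : p.Prime).ne_zero)
  (WittVector.ghostEquiv p ℂ_[p]).symm fun n => if n ≤ m then π (m - n) else 0

/-- The substitution `f(x) ↦ f(x ^ d)` (for `d ≥ 1`). -/
def substPow (d : ℕ) (f : ℂ_[p]⟦X⟧) : ℂ_[p]⟦X⟧ :=
  PowerSeries.subst (PowerSeries.X ^ d : ℂ_[p]⟦X⟧) f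

/-- The Pulita exponential `θ_m(a) = E(ϖ_m a)(x) / E(ϖ_m a^φ)(x ^ p)`. -/
def pulitaExp (φ : ℂ_[p] →+* ℂ_[p]) (π : ℕ → ℂ_[p]) (m : ℕ) (a : WittVector p ℂ_[p]) :
    ℂ_[p]⟦X⟧ :=
  artinHasseMap (varpi π m * a) *
    (substPow p (artinHasseMap (varpi π m * WittVector.map φ a)))⁻¹

/-- The generalized Pulita exponential
`θ_{m,s}(a) = ∏_{0 ≤ i < s} θ_m(a^{φ^i})(x ^ (p ^ i))`. -/
def pulitaExpGen (φ : ℂ_[p] →+* ℂ_[p]) (π : ℕ → ℂ_[p]) (m s : ℕ) (a : WittVector p ℂ_[p]) :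
    ℂ_[p]⟦X⟧ :=
  ∏ i ∈ Finset.range s, substPow (p ^ i) (pulitaExp φ π m (WittVector.map (φ ^ i) a))

/-- `Ω_{ℓ,s,t}(x_0, …, x_{ℓ-1}) = ∏_j θ_{ℓ-j-1,s}(1)(t ^ (p ^ j) x_j)`. -/
def Omega (φ : ℂ_[p] →+* ℂ_[p]) (π : ℕ → ℂ_[p]) (ℓ s : ℕ) (t : ℂ_[p]) :
    MvPowerSeries (Fin ℓ) ℂ_[p] :=
  ∏ j : Fin ℓ, PowerSeries.subst
    (MvPowerSeries.C (t ^ p ^ (j : ℕ)) * MvPowerSeries.X j : MvPowerSeries (Fin ℓ) ℂ_[p])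
    (pulitaExpGen φ π (ℓ - 1 - j) s 1)

/-! ### Splitting functions -/

/-- The Teichmüller lift of `x ∈ k` attached to the reduction morphism `red : ℤ_p[μ_{q-1}] → k`,
where `q = p ^ s`: the unique `z ∈ ℤ_p[μ_{q-1}]` with `z ^ q = z` and reduction `x`. -/
def teich {s : ℕ} {k : Type u} [Field k] (red : ringMu p s →+* k) (x : k) : ℂ_[p] :=
  ((Classical.epsilon fun z : ringMu p s => z ^ p ^ s = z ∧ red z = x : ringMu p s) : ℂ_[p])

/-- The term of index `n` of the series `Ω` at the point `x`. -/
def termAt {ℓ : ℕ} (Ω : MvPowerSeries (Fin ℓ) ℂ_[p]) (x : Fin ℓ → ℂ_[p]) (n : Fin ℓ →₀ ℕ) :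
    ℂ_[p] :=
  MvPowerSeries.coeff n Ω * ∏ i, x i ^ n i

/-- The value of the series `Ω` at the point `x`. -/
def evalAt {ℓ : ℕ} (Ω : MvPowerSeries (Fin ℓ) ℂ_[p]) (x : Fin ℓ → ℂ_[p]) : ℂ_[p] :=
  ∑' n, termAt Ω x n

/-- `Ω` is an `s`-splitting function of level `ℓ`, with coefficients in the subring `R`. Here `k`
is the field with `q = p ^ s` elements, with its reduction morphism `red`; an extension `k'` of
degree `r` carries a reduction morphism `red'` that is compatible with `red`. -/
structure IsSplittingFunction {s : ℕ} {k : Type u} [Field k] [Fintype k]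
    (red : ringMu p s →+* k) (ℓ : ℕ) (R : Subring ℂ_[p])
    (Ω : MvPowerSeries (Fin ℓ) ℂ_[p]) : Prop where
  coeff_mem : ∀ n, MvPowerSeries.coeff n Ω ∈ R
  converges : ∃ ρ : Fin ℓ → ℝ, (∀ i, 1 < ρ i) ∧
    ∀ x : Fin ℓ → ℂ_[p], (∀ i, ‖x i‖ < ρ i) → Summable (termAt Ω x)
  character : ∃ ψ : AddChar (TruncatedWittVector p ℓ k) ℂ_[p],
    (∀ y, ψ y = evalAt Ω fun j => teich red (y.coeff j)) ∧
    orderOf ψ = p ^ ℓ ∧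
    ∀ r : ℕ, 1 ≤ r → ∀ (k' : Type u) [Field k'] [Finite k'] [Algebra k k'],
      Module.finrank k k' = r →
      ∀ red' : ringMu p (s * r) →+* k',
        (∀ z : ringMu p s, red' (Subring.inclusion (ringMu_le p s r) z) =
          algebraMap k k' (red z)) →
        ∀ y : TruncatedWittVector p ℓ k',
          ψ (wittTrace p k k' ℓ y) =
            ∏ i ∈ Finset.range r,
              evalAt Ω fun j => teich red' (y.coeff j) ^ (p ^ s) ^ i

end SplittingFunctions

end

/-!
Every series involved is the exponential of `∑ w_n X ^ (p ^ n) / p ^ n` for a sequence `w` of ghost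
components (`ghostExp`), so that identities between Artin-Hasse exponentials reduce to identities
between ghost components; for instance `θ_{m,s}(1) = E(ϖ_m)(X) / E(ϖ_m)(X ^ q)`.

*Integrality.* Substituting `F` is an endomorphism of `ℤ_p⟦T⟧` that lifts the Frobenius, so by
Dwork's lemma (`sum_dworkComp`) the sequence `H, H ∘ F, H ∘ F ∘ F, …` consists of the ghost
components of a Witt vector over `ℤ_p⟦T⟧`. For `H = T`, its value at `π_m` is `ϖ_m`. The
components of `ϖ_m` are therefore values of power series without constant term, hence of norm at
most `‖π_m‖`; by Weierstrass division they lie in `𝒪`. As the Artin-Hasse series is integral,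
`E(ϖ_m)` has coefficients in `𝒪`.

*Overconvergence.* Write `F = T (p + H)` and let `v` be the Witt vector with ghost components
`H(π_{m+1}), H(π_m), …`; its components are topologically nilpotent. Then `ϖ_{m+1} v` is
`ϖ_m - p ϖ_{m+1}`, which differs from `ϖ_m - V ϖ_m` by its first ghost component only, whence
`θ_m(1) = exp(p π_{m+1} X) E(ϖ_{m+1} v)` (`pulitaExp_one_eq`). The first factor is overconvergent,
and `E(ϖ_{m+1} v)` is a finite product of series `E(ϖ_{m+1-j})(v_j X ^ (p ^ j))` with integral
coefficients before the substitution and `‖v_j‖ < 1`. For `m = 0` the same factorization gives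
`θ_0(1)(u) ≈ 1 + π_0 u` up to terms smaller than `π_0`.

*Functional equation.* For a Witt vector `a` over `ℂ_p`, the quotient of `E(ϖ_{ℓ-1} a)(X)` by the
series `E(ϖ_{ℓ-1} a')(X ^ q)`, where `a'` has the components `a_j ^ q`, is the product of the
`θ_{ℓ-1-j,s}(1)(a_j X ^ (p ^ j))`; at `X = 1` and for `a = [t] (x_0, x_1, …)` its value is `Ω(x)`.
As `E(ϖ_{ℓ-1} a)` is multiplicative in `a`, and is overconvergent if the components of `a` are
topologically nilpotent, in which case its values at `X` and at `X ^ q` agree for `X = 1`, the value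
`Ω` turns sums up to topologically nilpotent components into products (`wittValue_eq_prod`,
`evalAt_Omega_eq_prod`). Teichmüller representatives of sums and of traces are of this kind: the
kernel of a reduction morphism is topologically nilpotent because `ℤ_p[μ_{q-1}]` is compact. This
yields the additivity of the character and the trace formula.

*Order.* `W_ℓ(k)` is killed by `p ^ ℓ`. On `p ^ (ℓ - 1) W_ℓ(k)` the character is
`u ↦ θ_{0,s}(1)(u) ≈ 1 + π_0 ∑_{i < s} u ^ (p ^ i)`, where `u` runs through all Teichmüller points
as `t ≠ 0`. The polynomial `∑_{i < s} X ^ (p ^ i)` has degree less than `q`, so it does not vanish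
identically on `k`, and the character is not trivial there.
-/

noncomputable section

namespace SplittingFunctions

universe u

/-! ### Exponentials of ghost sequences -/

section GhostExp

open PowerSeries

variable {K : Type*} [Field K] [CharZero K]

/-- A power series with vanishing constant coefficient that satisfies a homogeneous linear
differential equation of order one is zero. -/
theorem eq_zero_of_derivative_eq_mul {f u : K⟦X⟧} (h0 : constantCoeff f = 0)
    (hd : d⁄dX K f = u * f) : f = 0 := by
  ext n
  induction n using Nat.strong_induction_on with
  | _ n ih =>
    rcases n with _ | n
    · simpa using h0
    · have h := congrArg (coeff n) hd
      rw [coeff_derivative, coeff_mul] at h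
      have hz : ∑ x ∈ Finset.HasAntidiagonal.antidiagonal n, coeff x.1 u * coeff x.2 f = 0 := by
        refine Finset.sum_eq_zero fun x hx => ?_
        rw [ih x.2 (by have := Finset.HasAntidiagonal.mem_antidiagonal.mp hx; omega)]
        simp
      rw [hz] at h
      have : (n + 1 : K) ≠ 0 := by exact_mod_cast Nat.succ_ne_zero n
      simpa [this] using h

/-- The exponential of a sum: both sides solve the same linear differential equation. -/
theorem exp_subst_add {g h : K⟦X⟧} (hg : constantCoeff g = 0) (hh : constantCoeff h = 0) :
    (exp K).subst (g + h) = (exp K).subst g * (exp K).subst h := by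
  have hg' := HasSubst.of_constantCoeff_zero' hg
  have hh' := HasSubst.of_constantCoeff_zero' hh
  have hcc : ∀ {g : K⟦X⟧}, constantCoeff g = 0 → constantCoeff ((exp K).subst g) = 1 := by
    intro g hg
    have h1 : (exp K).subst g = (exp K - 1).subst g + 1 := by
      have hs := HasSubst.of_constantCoeff_zero' hg
      rw [subst_sub hs]
      have : (1 : K⟦X⟧).subst g = (1 : K⟦X⟧) := by
        rw [← coe_substAlgHom hs, map_one]
      rw [this]; ring
    rw [h1, map_add, map_one]
    have := constantCoeff_subst_eq_zero (a := g) hg (exp K - 1) (by simp)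
    have h2 : constantCoeff ((exp K - 1).subst g) = 0 := this
    rw [h2, zero_add]
  rw [← sub_eq_zero]
  apply eq_zero_of_derivative_eq_mul (u := d⁄dX K g + d⁄dX K h)
  · rw [map_sub, map_mul, hcc hg, hcc hh, hcc (by simp [hg, hh])]; simp
  · rw [map_sub, Derivation.leibniz, derivative_subst (hg'.add hh'), derivative_subst hg',
      derivative_subst hh', derivative_exp]
    simp only [smul_eq_mul, map_add]
    ring

omit [CharZero K] in
theorem coeff_subst_C_mul_X_pow (f : K⟦X⟧) (c : K) {d : ℕ} (hd : d ≠ 0) (n : ℕ) :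
    coeff n (f.subst (C c * X ^ d : K⟦X⟧)) =
      if d ∣ n then coeff (n / d) f * c ^ (n / d) else 0 := by
  have hs : HasSubst (C c * X ^ d : K⟦X⟧) := HasSubst.of_constantCoeff_zero' (by simp [hd])
  rw [coeff_subst' hs]
  have hk : ∀ k, coeff n ((C c * X ^ d : K⟦X⟧) ^ k) = if n = d * k then c ^ k else 0 := by
    intro k
    rw [mul_pow, ← map_pow, ← pow_mul, coeff_C_mul, coeff_X_pow]
    simp
  simp only [hk]
  split_ifs with h
  · obtain ⟨k, rfl⟩ := h
    rw [Nat.mul_div_cancel_left _ (Nat.pos_of_ne_zero hd), finsum_eq_single _ k]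
    · simp
    · intro k' hk'
      rw [if_neg, smul_zero]
      exact fun h => hk' (Nat.eq_of_mul_eq_mul_left (Nat.pos_of_ne_zero hd) h).symm
  · rw [finsum_eq_zero_of_forall_eq_zero]
    intro k
    rw [if_neg, smul_zero]
    rintro rfl
    exact h (dvd_mul_right _ _)

variable (p : ℕ) [Fact p.Prime]

/-- The series `∑ w_n X ^ (p ^ n) / p ^ n`. An exponent `d` is a power of `p` if and only if it is
`p ^ Nat.log p d`. -/
def ghostLog (w : ℕ → K) : K⟦X⟧ :=
  PowerSeries.mk fun d => if d = p ^ Nat.log p d then w (Nat.log p d) / d else 0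

/-- The exponential of the series `∑ w_n X ^ (p ^ n) / p ^ n`. -/
def ghostExp (w : ℕ → K) : K⟦X⟧ :=
  (exp K).subst (ghostLog p w)

variable {p}

omit [CharZero K] in
theorem coeff_ghostLog_pow (w : ℕ → K) (n : ℕ) :
    coeff (p ^ n) (ghostLog p w) = w n / (p : K) ^ n := by
  simp [ghostLog, Nat.log_pow (Fact.out : p.Prime).one_lt]

omit [CharZero K] [Fact p.Prime] in
theorem coeff_ghostLog_of_ne (w : ℕ → K) {d : ℕ} (hd : ∀ n, d ≠ p ^ n) :
    coeff d (ghostLog p w) = 0 := by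
  simp [ghostLog, hd]

omit [CharZero K] in
theorem constantCoeff_ghostLog (w : ℕ → K) : constantCoeff (ghostLog p w) = 0 := by
  rw [← coeff_zero_eq_constantCoeff_apply]
  exact coeff_ghostLog_of_ne w fun n => (pow_ne_zero n (Fact.out : p.Prime).ne_zero).symm

omit [CharZero K] in
theorem hasSubst_ghostLog (w : ℕ → K) : HasSubst (ghostLog p w) :=
  HasSubst.of_constantCoeff_zero' (constantCoeff_ghostLog w)

omit [Fact p.Prime] in
theorem ghostLog_add (w w' : ℕ → K) : ghostLog p (w + w') = ghostLog p w + ghostLog p w' := by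
  ext d
  simp only [ghostLog, map_add, coeff_mk, Pi.add_apply]
  split_ifs
  · ring
  · simp

theorem ghostExp_add (w w' : ℕ → K) : ghostExp p (w + w') = ghostExp p w * ghostExp p w' := by
  rw [ghostExp, ghostLog_add, exp_subst_add (constantCoeff_ghostLog w) (constantCoeff_ghostLog w')]
  rfl

omit [Fact p.Prime] in
theorem ghostExp_zero : ghostExp p (0 : ℕ → K) = 1 := by
  have h : ghostLog p (0 : ℕ → K) = 0 := by ext d; simp [ghostLog]
  rw [ghostExp, h, subst_zero_eq_C_constantCoeff]
  simp

theorem ghostExp_mul_neg (w : ℕ → K) : ghostExp p w * ghostExp p (-w) = 1 := by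
  rw [← ghostExp_add, add_neg_cancel, ghostExp_zero]

theorem ghostExp_sum {ι : Type*} (s : Finset ι) (w : ι → ℕ → K) :
    ghostExp p (∑ i ∈ s, w i) = ∏ i ∈ s, ghostExp p (w i) := by
  classical
  induction s using Finset.induction_on with
  | empty => simp [ghostExp_zero]
  | insert a s ha ih => rw [Finset.sum_insert ha, Finset.prod_insert ha, ghostExp_add, ih]

theorem ghostExp_nsmul (n : ℕ) (w : ℕ → K) : ghostExp p (n • w) = ghostExp p w ^ n := by
  have h := ghostExp_sum (p := p) (Finset.range n) fun _ => w
  simpa using h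

/-- The ghost components of `V ^ j ([c] · a)` in terms of those of `a`. -/
def ghostShift (p j : ℕ) (c : K) (w : ℕ → K) (n : ℕ) : K :=
  if j ≤ n then (p : K) ^ j * c ^ p ^ (n - j) * w (n - j) else 0

theorem ghostLog_subst (c : K) (j : ℕ) (w : ℕ → K) :
    (ghostLog p w).subst (C c * X ^ p ^ j : K⟦X⟧) = ghostLog p (ghostShift p j c w) := by
  have hp : p ≠ 0 := (Fact.out : p.Prime).ne_zero
  have hpj : p ^ j ≠ 0 := pow_ne_zero _ hp
  ext d
  rw [coeff_subst_C_mul_X_pow _ _ hpj]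
  by_cases hd : ∃ n, d = p ^ n
  · obtain ⟨n, rfl⟩ := hd
    simp only [coeff_ghostLog_pow, Nat.pow_dvd_pow_iff_le_right (Fact.out : p.Prime).one_lt,
      ghostShift]
    split_ifs with h
    · rw [Nat.pow_div h (Nat.pos_of_ne_zero hp), coeff_ghostLog_pow]
      have hpK : (p : K) ≠ 0 := Nat.cast_ne_zero.mpr hp
      obtain ⟨i, rfl⟩ := Nat.exists_eq_add_of_le h
      rw [Nat.add_sub_cancel_left, pow_add]
      field_simp
    · simp
  · push Not at hd
    rw [coeff_ghostLog_of_ne _ hd]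
    split_ifs with h
    · obtain ⟨e, rfl⟩ := h
      rw [Nat.mul_div_cancel_left _ (Nat.pos_of_ne_zero hpj), coeff_ghostLog_of_ne, zero_mul]
      rintro n rfl
      exact hd (j + n) (pow_add _ _ _).symm
    · rfl

omit [CharZero K] in
theorem hasSubst_C_mul_X_pow (c : K) (j : ℕ) : HasSubst (C c * X ^ p ^ j : K⟦X⟧) :=
  HasSubst.of_constantCoeff_zero' (by simp [(Fact.out : p.Prime).ne_zero])

theorem ghostExp_subst (c : K) (j : ℕ) (w : ℕ → K) :
    (ghostExp p w).subst (C c * X ^ p ^ j : K⟦X⟧) = ghostExp p (ghostShift p j c w) := by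
  rw [ghostExp, subst_comp_subst_apply (hasSubst_ghostLog w) (hasSubst_C_mul_X_pow c j),
    ghostLog_subst]
  rfl

theorem constantCoeff_ghostExp (w : ℕ → K) : constantCoeff (ghostExp p w) = 1 := by
  have h := congrArg (coeff 0) (ghostExp_subst (p := p) 0 0 w)
  have h0 : ghostShift p 0 (0 : K) w = 0 := by
    ext n; simp [ghostShift, (Fact.out : p.Prime).ne_zero]
  rw [coeff_subst_C_mul_X_pow _ _ (by simp), h0, ghostExp_zero] at h
  simpa using h

/-- Changing `w` beyond index `N` multiplies its exponential by a series in `X ^ (p ^ (N + 1))`. -/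
theorem coeff_ghostExp_congr {w w' : ℕ → K} {N : ℕ} (h : ∀ k ≤ N, w k = w' k) {n : ℕ}
    (hn : n ≤ N) : coeff n (ghostExp p w) = coeff n (ghostExp p w') := by
  have hp : (p : K) ≠ 0 := Nat.cast_ne_zero.mpr (Fact.out : p.Prime).ne_zero
  obtain ⟨δ, hδ⟩ : ∃ δ : ℕ → K, w = w' + ghostShift p (N + 1) 1 δ := by
    refine ⟨fun n => (w (n + (N + 1)) - w' (n + (N + 1))) / (p : K) ^ (N + 1), ?_⟩
    ext k
    simp only [ghostShift, Pi.add_apply, one_pow, mul_one]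
    split_ifs with hk
    · rw [Nat.sub_add_cancel hk]; field_simp; ring
    · rw [h k (by omega), add_zero]
  have hlt : N + 1 < p ^ (N + 1) := Nat.lt_pow_self (Fact.out : p.Prime).one_lt
  rw [hδ, ghostExp_add, ← ghostExp_subst, coeff_mul,
    Finset.sum_eq_single_of_mem (n, 0) (by simp)]
  · rw [coeff_subst_C_mul_X_pow _ _ (by omega)]
    have : coeff 0 (ghostExp p δ) = (1 : K) := by
      rw [coeff_zero_eq_constantCoeff_apply, constantCoeff_ghostExp]
    simp [constantCoeff_ghostExp]
  · rintro ⟨a, b⟩ hab hne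
    have hab' := Finset.HasAntidiagonal.mem_antidiagonal.mp hab
    simp only at hab' ⊢
    rw [coeff_subst_C_mul_X_pow _ _ (by omega), if_neg, mul_zero]
    intro hdvd
    have hb : b ≠ 0 := by
      rintro rfl
      exact hne (by rw [Prod.mk.injEq]; omega)
    have := Nat.le_of_dvd (Nat.pos_of_ne_zero hb) hdvd
    omega

variable (p) in
theorem artinHasse_eq_ghostExp : artinHasse p = ghostExp p (1 : ℕ → ℚ) := by
  unfold artinHasse ghostExp
  congr 1
  ext d
  rw [coeff_mk]
  split_ifs with h
  · obtain ⟨n, rfl⟩ := h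
    rw [coeff_ghostLog_pow]; simp
  · push Not at h
    rw [coeff_ghostLog_of_ne _ h]

theorem map_ghostExp {K' : Type*} [Field K'] [CharZero K'] (f : K →+* K') (w : ℕ → K) :
    PowerSeries.map f (ghostExp p w) = ghostExp p fun n => f (w n) := by
  have hlog : PowerSeries.map f (ghostLog p w) = ghostLog p fun n => f (w n) := by
    ext d
    simp only [ghostLog, coeff_map, coeff_mk]
    split_ifs <;> simp
  have h := PowerSeries.map_subst (hasSubst_ghostLog (p := p) w) (h := f) (exp K)
  rw [ghostExp, ghostExp, ← hlog]
  refine Eq.trans h ?_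
  rw [map_exp]
  rfl

end GhostExp

/-! ### The Artin-Hasse morphism in ghost components -/

section ArtinHasse

open PowerSeries

variable {p : ℕ} [Fact p.Prime]

theorem artinHasseAt_pow (a : ℂ_[p]) (i : ℕ) :
    artinHasseAt a (p ^ i) = ghostExp p (ghostShift p i a 1) := by
  rw [artinHasseAt, artinHasse_eq_ghostExp, map_ghostExp, ← ghostExp_subst]
  congr 2
  ext n
  simp

/-- The Artin-Hasse morphism is the exponential of the ghost components. -/
theorem artinHasseMap_eq_ghostExp (a : WittVector p ℂ_[p]) :
    artinHasseMap a = ghostExp p fun n => WittVector.ghostComponent n a := by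
  ext n
  rw [artinHasseMap, coeff_mk]
  simp only [artinHasseAt_pow]
  rw [← ghostExp_sum]
  refine coeff_ghostExp_congr (N := n) (fun k hk => ?_) le_rfl
  rw [WittVector.ghostComponent_apply, aeval_wittPolynomial, Finset.sum_apply]
  symm
  refine Finset.sum_subset_zero_on_sdiff (Finset.range_mono (by omega)) ?_ ?_
  · intro i hi
    simp only [Finset.mem_sdiff, Finset.mem_range] at hi
    rw [ghostShift, if_neg (by omega)]
  · intro i hi
    simp only [Finset.mem_range] at hi
    rw [ghostShift, if_pos (by omega)]
    simp

theorem substPow_eq (d : ℕ) (f : ℂ_[p]⟦X⟧) :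
    substPow d f = f.subst (C 1 * X ^ d : ℂ_[p]⟦X⟧) := by
  rw [substPow, map_one, one_mul]

theorem ghostComponent_varpi (π : ℕ → ℂ_[p]) (m n : ℕ) :
    WittVector.ghostComponent n (varpi π m) = if n ≤ m then π (m - n) else 0 := by
  let : Invertible (p : ℂ_[p]) :=
    invertibleOfNonzero (Nat.cast_ne_zero.mpr (Fact.out : p.Prime).ne_zero)
  have h : WittVector.ghostEquiv p ℂ_[p] (varpi π m) = fun n => if n ≤ m then π (m - n) else 0 :=
    RingEquiv.apply_symm_apply _ _
  exact congrFun h n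

end ArtinHasse

/-! ### Integrality of the Artin-Hasse series -/

section Integrality

open PowerSeries

theorem coeff_ghostExp_single {p : ℕ} [Fact p.Prime] {K : Type*} [Field K] [CharZero K] (c : K)
    (n : ℕ) : coeff n (ghostExp p (Pi.single 0 c)) = c ^ n / (n.factorial : K) := by
  have hlog : ghostLog p (Pi.single 0 c : ℕ → K) = (C c * X ^ 1 : K⟦X⟧) := by
    ext d
    rw [coeff_C_mul, coeff_X_pow]
    by_cases hd : ∃ k, d = p ^ k
    · obtain ⟨k, rfl⟩ := hd
      rw [coeff_ghostLog_pow]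
      rcases Nat.eq_zero_or_pos k with rfl | hk
      · simp
      · rw [Pi.single_eq_of_ne (by omega), if_neg (Nat.one_lt_pow (by omega)
          (Fact.out : p.Prime).one_lt).ne']
        simp
    · push Not at hd
      rw [coeff_ghostLog_of_ne _ hd, if_neg (by simpa using hd 0), mul_zero]
  rw [ghostExp, hlog, coeff_subst_C_mul_X_pow _ _ one_ne_zero]
  simp [coeff_exp]
  ring

theorem norm_pow_div_factorial_le (p : ℕ) [Fact p.Prime] {n : ℕ} (hn : n ≠ 0) :
    ‖(p : ℚ_[p]) ^ n / (n.factorial : ℚ_[p])‖ ≤ ‖(p : ℚ_[p])‖ := by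
  have h1 : (padicValNat p n.factorial) < n :=
    padicValNat_factorial_lt_of_ne_zero p hn
  have hp : (1 : ℝ) < p := by exact_mod_cast (Fact.out : p.Prime).one_lt
  have h2 : ‖((n.factorial : ℕ) : ℚ_[p])‖ = (p : ℝ) ^ (-(padicValNat p n.factorial : ℤ)) := by
    rw [Padic.norm_eq_zpow_neg_valuation (by exact_mod_cast n.factorial_ne_zero)]
    simp
  rw [norm_div, norm_pow, h2, Padic.norm_p, ← zpow_natCast, ← zpow_neg_one, ← zpow_mul,
    ← zpow_sub₀ (by positivity)]
  exact zpow_le_zpow_right₀ hp.le (by omega)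

variable {p : ℕ} [Fact p.Prime]

theorem dvd_coeff_pow_sub_expand (A : Polynomial ℤ_[p]) (n : ℕ) :
    (p : ℤ_[p]) ∣ (A ^ p - Polynomial.expand ℤ_[p] p A).coeff n := by
  have h : (A ^ p - Polynomial.expand ℤ_[p] p A).map PadicInt.toZMod = 0 := by
    rw [Polynomial.map_sub, Polynomial.map_pow, Polynomial.map_expand, ZMod.expand_card, sub_self]
  have h2 := congrArg (fun q => Polynomial.coeff q n) h
  simp only [Polynomial.coeff_map, Polynomial.coeff_zero] at h2
  rw [← RingHom.mem_ker, PadicInt.ker_toZMod, PadicInt.maximalIdeal_eq_span_p,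
    Ideal.mem_span_singleton] at h2
  exact h2

/-- The functional equation `AH(X) ^ p = AH(X ^ p) exp(pX)`. -/
theorem ghostExp_one_pow {K : Type*} [Field K] [CharZero K] :
    ghostExp p (1 : ℕ → K) ^ p =
      (ghostExp p (1 : ℕ → K)).subst (C 1 * X ^ p ^ 1 : K⟦X⟧) *
        ghostExp p (Pi.single 0 (p : K)) := by
  rw [← ghostExp_nsmul, ghostExp_subst, ← ghostExp_add]
  congr 1
  ext n
  rcases n with _ | n
  · simp [ghostShift]
  · simp [ghostShift]

/-- The Artin-Hasse series has `p`-integral coefficients: by its functional equation, the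
coefficient `c` of degree `n` satisfies `p c ∈ p ℤ_p` once those of smaller degree are integral. -/
theorem norm_coeff_ghostExp_one_le (n : ℕ) : ‖coeff n (ghostExp p (1 : ℕ → ℚ_[p]))‖ ≤ 1 := by
  set f := ghostExp p (1 : ℕ → ℚ_[p]) with hf
  have hp : p ≠ 0 := (Fact.out : p.Prime).ne_zero
  have hcc : constantCoeff f = 1 := constantCoeff_ghostExp _
  induction n using Nat.strong_induction_on with
  | _ n ih =>
  rcases Nat.eq_zero_or_pos n with rfl | hn
  · simp [hcc]
  let a : ℕ → ℤ_[p] := fun i => if h : i < n then ⟨coeff i f, ih i h⟩ else 0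
  have ha : ∀ i, i < n → ((a i : ℤ_[p]) : ℚ_[p]) = coeff i f := by
    intro i hi
    simp [a, hi]
  let A : Polynomial ℤ_[p] := ∑ i ∈ Finset.range n, Polynomial.monomial i (a i)
  have hA : ∀ i, i < n → ((A.coeff i : ℤ_[p]) : ℚ_[p]) = coeff i f := by
    intro i hi
    have : A.coeff i = a i := by
      simp [A, Polynomial.finsetSum_coeff, Polynomial.coeff_monomial, hi]
    rw [this, ha i hi]
  let A' : ℚ_[p]⟦X⟧ := ((A.map PadicInt.Coe.ringHom : Polynomial ℚ_[p]) : ℚ_[p]⟦X⟧)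
  have hA' : ∀ i, coeff i A' = ((A.coeff i : ℤ_[p]) : ℚ_[p]) := by
    intro i
    simp [A']
    rfl
  have hdvd : (X : ℚ_[p]⟦X⟧) ^ n ∣ f - A' := by
    rw [X_pow_dvd_iff]
    intro i hi
    rw [map_sub, hA', hA i hi, sub_self]
  obtain ⟨h, hh⟩ := hdvd
  obtain ⟨k, hk⟩ := Polynomial.powAddExpansion A' (X ^ n * h) p
  have hA'n : coeff n A' = 0 := by
    rw [hA']
    have : A.coeff n = 0 := by
      simp [A, Polynomial.finsetSum_coeff, Polynomial.coeff_monomial]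
    rw [this]; simp
  have hh0 : constantCoeff h = coeff n f := by
    have := congrArg (coeff n) hh
    rw [map_sub, hA'n, sub_zero] at this
    rw [this, coeff_X_pow_mul']
    simp
  have hcA : constantCoeff A' = 1 := by
    rw [← coeff_zero_eq_constantCoeff_apply, hA', hA 0 hn, coeff_zero_eq_constantCoeff_apply, hcc]
  have hL : coeff n (f ^ p) = coeff n (A' ^ p) + p * coeff n f := by
    have : f = A' + X ^ n * h := by rw [← hh]; ring
    rw [this, hk, ← this, map_add, map_add]
    have e1 : coeff n ((p : ℚ_[p]⟦X⟧) * A' ^ (p - 1) * (X ^ n * h)) = p * coeff n f := by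
      rw [show (p : ℚ_[p]⟦X⟧) * A' ^ (p - 1) * (X ^ n * h) =
        X ^ n * ((p : ℚ_[p]⟦X⟧) * A' ^ (p - 1) * h) by ring, coeff_X_pow_mul']
      simp [hcA, hh0]
    have e2 : coeff n (k * (X ^ n * h) ^ 2) = 0 := by
      rw [show k * (X ^ n * h) ^ 2 = X ^ (2 * n) * (k * h ^ 2) by ring, coeff_X_pow_mul',
        if_neg (by omega)]
    rw [e1, e2, add_zero]
  have hpp : ‖(p : ℚ_[p])‖ ≤ 1 := Padic.norm_p_lt_one.le
  have hsub : ∀ i, i ≤ n →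
      coeff i (f.subst (C 1 * X ^ p ^ 1 : ℚ_[p]⟦X⟧)) =
        (((Polynomial.expand ℤ_[p] p A).coeff i : ℤ_[p]) : ℚ_[p]) := by
    intro i hi
    rw [coeff_subst_C_mul_X_pow _ _ (by simpa using hp), pow_one,
      Polynomial.coeff_expand (Nat.pos_of_ne_zero hp)]
    split_ifs with hd
    · rw [one_pow, mul_one, hA]
      rcases Nat.eq_zero_or_pos i with rfl | hi0
      · simpa using hn
      · exact (Nat.div_lt_self hi0 (Fact.out : p.Prime).one_lt).trans_le hi
    · simp
  have hfe : (p : ℚ_[p]) * coeff n f =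
      - (((A ^ p - Polynomial.expand ℤ_[p] p A).coeff n : ℤ_[p]) : ℚ_[p]) +
      ∑ x ∈ (Finset.HasAntidiagonal.antidiagonal n).erase (n, 0),
        coeff x.1 (f.subst (C 1 * X ^ p ^ 1 : ℚ_[p]⟦X⟧)) *
          coeff x.2 (ghostExp p (Pi.single 0 (p : ℚ_[p]))) := by
    have h1 : coeff n (f ^ p) = _ := congrArg (coeff n) (ghostExp_one_pow (p := p) (K := ℚ_[p]))
    rw [hL, coeff_mul, ← Finset.add_sum_erase _ _
      (show (n, 0) ∈ Finset.HasAntidiagonal.antidiagonal n by simp)] at h1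
    simp only [← hf] at h1
    rw [hsub n le_rfl, coeff_zero_eq_constantCoeff_apply, constantCoeff_ghostExp, mul_one] at h1
    have h2 : coeff n (A' ^ p) = (((A ^ p).coeff n : ℤ_[p]) : ℚ_[p]) := by
      have : A' ^ p = (((A ^ p).map PadicInt.Coe.ringHom : Polynomial ℚ_[p]) : ℚ_[p]⟦X⟧) := by
        simp [A']
      rw [this, Polynomial.coeff_coe, Polynomial.coeff_map]
      rfl
    rw [h2] at h1
    rw [Polynomial.coeff_sub]
    push_cast
    linear_combination h1
  have hle : ‖(p : ℚ_[p]) * coeff n f‖ ≤ ‖(p : ℚ_[p])‖ := by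
    rw [hfe]
    refine (IsUltrametricDist.norm_add_le_max _ _).trans (max_le ?_ ?_)
    · obtain ⟨c, hc⟩ := dvd_coeff_pow_sub_expand A n
      rw [norm_neg, hc, PadicInt.coe_mul, norm_mul]
      simpa using mul_le_mul_of_nonneg_left c.2 (norm_nonneg (p : ℚ_[p]))
    · refine IsUltrametricDist.norm_sum_le_of_forall_le_of_nonneg (norm_nonneg _) ?_
      rintro ⟨i, j⟩ hij
      rw [Finset.mem_erase, Finset.HasAntidiagonal.mem_antidiagonal] at hij
      have hj : j ≠ 0 := by
        rintro rfl
        exact hij.1 (by rw [Prod.mk.injEq]; omega)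
      rw [norm_mul, hsub i (by omega), coeff_ghostExp_single]
      calc _ ≤ 1 * ‖(p : ℚ_[p])‖ :=
            mul_le_mul (PadicInt.norm_le_one _) (norm_pow_div_factorial_le p hj) (norm_nonneg _)
              zero_le_one
        _ = _ := one_mul _
  rw [norm_mul] at hle
  have hp0 : 0 < ‖(p : ℚ_[p])‖ := norm_pos_iff.mpr (by exact_mod_cast hp)
  exact le_of_mul_le_mul_left (by simpa using hle) hp0

theorem exists_map_eq_artinHasse :
    ∃ A : ℤ_[p]⟦X⟧, PowerSeries.map (ofPadicInt p) A =
      PowerSeries.map (Rat.castHom ℂ_[p]) (artinHasse p) := by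
  let a : ℕ → ℤ_[p] := fun n => ⟨_, norm_coeff_ghostExp_one_le n⟩
  refine ⟨PowerSeries.mk a, ?_⟩
  have h : PowerSeries.map (Rat.castHom ℂ_[p]) (artinHasse p) =
      PowerSeries.map (algebraMap ℚ_[p] ℂ_[p]) (ghostExp p 1) := by
    rw [artinHasse_eq_ghostExp, map_ghostExp, map_ghostExp]
    simp
  rw [h]
  ext n
  rw [coeff_map, coeff_mk, coeff_map]
  rfl

end Integrality

/-! ### Witt components attached to a Frobenius lift -/

section Dwork

variable {R : Type*} [CommRing R] (p : ℕ) [Fact p.Prime] (σ : R →+* R) (x : R)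

/-- The Witt components of the ghost sequence `x, σ x, σ² x, …`, chosen one after the other. They
solve the equations for the ghost components if `σ` lifts the Frobenius of `R / p`. -/
def dworkComp : ℕ → R
  | n => Classical.epsilon fun q =>
      σ^[n] x = ∑ i : Fin n, (p : R) ^ (i : ℕ) * dworkComp i ^ p ^ (n - i) + (p : R) ^ n * q

variable {p σ}

omit [Fact p.Prime] in
theorem dworkComp_spec {n : ℕ} (h : ∃ q : R, σ^[n] x =
    ∑ i ∈ Finset.range n, (p : R) ^ i * dworkComp p σ x i ^ p ^ (n - i) + (p : R) ^ n * q) :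
    ∑ i ∈ Finset.range (n + 1), (p : R) ^ i * dworkComp p σ x i ^ p ^ (n - i) = σ^[n] x := by
  rw [← Fin.sum_univ_eq_sum_range
    (fun i => (p : R) ^ i * dworkComp p σ x i ^ p ^ (n - i))] at h
  have h2 := Classical.epsilon_spec h
  rw [← dworkComp, Fin.sum_univ_eq_sum_range
    (fun i => (p : R) ^ i * dworkComp p σ x i ^ p ^ (n - i))] at h2
  rw [Finset.sum_range_succ, h2]
  simp

omit [Fact p.Prime] in
/-- If `σ` lifts the Frobenius of `R / p`, the sequence `x, σ x, σ² x, …` is the sequence of ghost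
components of a Witt vector over `R`. -/
theorem sum_dworkComp (hσ : ∀ y, (p : R) ∣ σ y - y ^ p) (n : ℕ) :
    ∑ i ∈ Finset.range (n + 1), (p : R) ^ i * dworkComp p σ x i ^ p ^ (n - i) = σ^[n] x := by
  induction n with
  | zero => exact dworkComp_spec x ⟨x, by simp⟩
  | succ n ih =>
    have hdvd : (p : R) ^ (n + 1) ∣ σ^[n + 1] x -
        ∑ i ∈ Finset.range (n + 1), (p : R) ^ i * dworkComp p σ x i ^ p ^ (n + 1 - i) := by
      rw [Function.iterate_succ_apply', ← ih, map_sum, ← Finset.sum_sub_distrib]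
      refine Finset.dvd_sum fun i hi => ?_
      have hi' : i ≤ n := by simpa [Nat.lt_succ_iff] using hi
      obtain ⟨k, rfl⟩ := Nat.exists_eq_add_of_le hi'
      have h := dvd_sub_pow_of_dvd_sub (hσ (dworkComp p σ x i)) k
      rw [map_mul, map_pow, map_pow, map_natCast, ← mul_sub,
        show i + k + 1 = i + (k + 1) by ring, pow_add, Nat.add_sub_cancel_left,
        Nat.add_sub_cancel_left, pow_succ' p, pow_mul]
      exact mul_dvd_mul_left _ h
    obtain ⟨q, hq⟩ := hdvd
    exact dworkComp_spec x ⟨q, by rw [← hq]; ring⟩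

theorem map_dworkComp_eq_zero (hσ : ∀ y, (p : R) ∣ σ y - y ^ p) {S : Type*} [CommRing S]
    [IsDomain S] [CharZero S] (κ : R →+* S) (hκ : ∀ n, κ (σ^[n] x) = 0) (n : ℕ) :
    κ (dworkComp p σ x n) = 0 := by
  induction n using Nat.strong_induction_on with
  | _ n ih =>
  have h := congrArg κ (sum_dworkComp x hσ n)
  rw [hκ, map_sum, Finset.sum_range_succ, Finset.sum_eq_zero] at h
  · have hp : (p : S) ≠ 0 := Nat.cast_ne_zero.mpr (Fact.out : p.Prime).ne_zero
    simpa [hp] using h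
  · intro i hi
    rw [map_mul, map_pow, map_pow, ih i (by simpa using hi), zero_pow, mul_zero]
    exact pow_ne_zero _ (Fact.out : p.Prime).ne_zero

end Dwork

/-! ### Lubin-Tate series as Frobenius lifts of `ℤ_p⟦T⟧` -/

section LubinTate

open PowerSeries

variable {p : ℕ} [Fact p.Prime] {F : ℤ_[p]⟦X⟧}

theorem IsLubinTate.constantCoeff (hF : IsLubinTate p F) : constantCoeff F = 0 := by
  obtain ⟨G, rfl⟩ := hF
  simp [(Fact.out : p.Prime).ne_zero]

theorem IsLubinTate.exists_eq_X_mul (hF : IsLubinTate p F) :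
    ∃ H : ℤ_[p]⟦X⟧, PowerSeries.constantCoeff H = 0 ∧ F = X * ((p : ℤ_[p]⟦X⟧) + H) := by
  obtain ⟨G, hG⟩ := hF
  have hp := (Fact.out : p.Prime).two_le
  refine ⟨X ^ (p - 1) + (p : ℤ_[p]⟦X⟧) * X * G, by simp [show p - 1 ≠ 0 by omega], ?_⟩
  rw [hG, mul_add, mul_add, ← pow_succ', show p - 1 + 1 = p by omega]
  ring

theorem natCast_dvd_of_map_eq_zero {H : ℤ_[p]⟦X⟧} (h : H.map (PadicInt.toZMod (p := p)) = 0) :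
    (p : ℤ_[p]⟦X⟧) ∣ H := by
  have h1 : ∀ n, ∃ c, coeff n H = p * c := by
    intro n
    have h2 := congrArg (coeff n) h
    rw [coeff_map, map_zero, ← RingHom.mem_ker, PadicInt.ker_toZMod,
      PadicInt.maximalIdeal_eq_span_p, Ideal.mem_span_singleton] at h2
    exact h2
  choose c hc using h1
  refine ⟨PowerSeries.mk c, ?_⟩
  ext n
  rw [← map_natCast (C (R := ℤ_[p])), coeff_C_mul, coeff_mk, hc]

/-- The endomorphism `H ↦ H ∘ F` of `ℤ_p⟦T⟧`. -/
def compHom (hF : IsLubinTate p F) : ℤ_[p]⟦X⟧ →+* ℤ_[p]⟦X⟧ :=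
  (substAlgHom (HasSubst.of_constantCoeff_zero' hF.constantCoeff) :
    ℤ_[p]⟦X⟧ →ₐ[ℤ_[p]] ℤ_[p]⟦X⟧).toRingHom

theorem compHom_apply (hF : IsLubinTate p F) (H : ℤ_[p]⟦X⟧) : compHom hF H = H.subst F := by
  rw [← coe_substAlgHom (HasSubst.of_constantCoeff_zero' hF.constantCoeff)]
  rfl

/-- As `F` is congruent to `T ^ p` modulo `p`, substituting `F` lifts the Frobenius. -/
theorem dvd_compHom_sub_pow (hF : IsLubinTate p F) (H : ℤ_[p]⟦X⟧) :
    (p : ℤ_[p]⟦X⟧) ∣ compHom hF H - H ^ p := by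
  apply natCast_dvd_of_map_eq_zero
  have hp : p ≠ 0 := (Fact.out : p.Prime).ne_zero
  have hs := HasSubst.of_constantCoeff_zero' hF.constantCoeff
  have hFmap : F.map (PadicInt.toZMod (p := p)) = X ^ p := by
    obtain ⟨G, rfl⟩ := hF
    have : ((p : ℕ) : (ZMod p)⟦X⟧) = 0 := by
      rw [← map_natCast (C (R := ZMod p)), CharP.cast_eq_zero, map_zero]
    simp [this]
  have h1 : PowerSeries.map (PadicInt.toZMod (p := p)) (H.subst F : ℤ_[p]⟦X⟧) =
      (H.map (PadicInt.toZMod (p := p))).subst (X ^ p : (ZMod p)⟦X⟧) := by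
    rw [← hFmap]
    exact PowerSeries.map_subst hs (h := PadicInt.toZMod (p := p)) H
  rw [map_sub, map_pow, compHom_apply, h1, ← expand_apply p hp, sub_eq_zero]
  have h2 := MvPowerSeries.map_frobenius_expand p hp (f := (H.map (PadicInt.toZMod (p := p))))
  rw [← h2, ZMod.frobenius_zmod, MvPowerSeries.map_id]
  rfl

theorem constantCoeff_iterate_compHom (hF : IsLubinTate p F) {H : ℤ_[p]⟦X⟧}
    (hH : PowerSeries.constantCoeff H = 0) (n : ℕ) :
    PowerSeries.constantCoeff ((compHom hF)^[n] H) = 0 := by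
  induction n with
  | zero => simpa using hH
  | succ n ih =>
    rw [Function.iterate_succ_apply', compHom_apply]
    exact constantCoeff_subst_eq_zero (a := F) hF.constantCoeff _ ih

theorem map_residue_iterate_compHom (hF : IsLubinTate p F) (n : ℕ) :
    ((compHom hF)^[n] X).map (IsLocalRing.residue ℤ_[p]) = X ^ p ^ n := by
  induction n with
  | zero => simp
  | succ n ih =>
    obtain ⟨c, hc⟩ := dvd_compHom_sub_pow hF ((compHom hF)^[n] X)
    have hp : ((p : ℕ) : (IsLocalRing.ResidueField ℤ_[p])⟦X⟧) = 0 := by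
      have : IsLocalRing.residue ℤ_[p] (p : ℤ_[p]) = 0 := by
        rw [IsLocalRing.residue_eq_zero_iff, PadicInt.maximalIdeal_eq_span_p]
        exact Ideal.mem_span_singleton_self _
      rw [← map_natCast (C (R := IsLocalRing.ResidueField ℤ_[p])),
        ← map_natCast (IsLocalRing.residue ℤ_[p]), this, map_zero]
    rw [sub_eq_iff_eq_add] at hc
    rw [Function.iterate_succ_apply', hc, map_add, map_mul, map_pow, ih, map_natCast, hp, zero_mul,
      zero_add, ← pow_mul, pow_succ]

end LubinTate

/-! ### Evaluation of power series -/

section Evaluation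

open PowerSeries

variable {p : ℕ} [Fact p.Prime]

/-- The value of the series `f` at `z`. -/
def evalSeries (f : ℂ_[p]⟦X⟧) (z : ℂ_[p]) : ℂ_[p] := ∑' n, coeff n f * z ^ n

/-- The series `f` converges absolutely at `z`. -/
def AbsConv (f : ℂ_[p]⟦X⟧) (z : ℂ_[p]) : Prop := Summable fun n => ‖coeff n f * z ^ n‖

theorem coeff_mul_mul_pow (f g : ℂ_[p]⟦X⟧) (z : ℂ_[p]) (n : ℕ) :
    coeff n (f * g) * z ^ n = ∑ kl ∈ Finset.HasAntidiagonal.antidiagonal n,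
      (coeff kl.1 f * z ^ kl.1) * (coeff kl.2 g * z ^ kl.2) := by
  rw [coeff_mul, Finset.sum_mul]
  refine Finset.sum_congr rfl fun x hx => ?_
  rw [← Finset.HasAntidiagonal.mem_antidiagonal.mp hx, pow_add]
  ring

theorem AbsConv.mul {f g : ℂ_[p]⟦X⟧} {z : ℂ_[p]} (hf : AbsConv f z) (hg : AbsConv g z) :
    AbsConv (f * g) z := by
  have := summable_norm_sum_mul_antidiagonal_of_summable_norm hf hg
  simpa only [AbsConv, coeff_mul_mul_pow] using this

theorem evalSeries_mul {f g : ℂ_[p]⟦X⟧} {z : ℂ_[p]} (hf : AbsConv f z) (hg : AbsConv g z) :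
    evalSeries (f * g) z = evalSeries f z * evalSeries g z := by
  simp only [evalSeries, coeff_mul_mul_pow]
  exact (tsum_mul_tsum_eq_tsum_sum_antidiagonal_of_summable_norm hf hg).symm

theorem AbsConv.add {f g : ℂ_[p]⟦X⟧} {z : ℂ_[p]} (hf : AbsConv f z) (hg : AbsConv g z) :
    AbsConv (f + g) z := by
  refine Summable.of_nonneg_of_le (fun _ => norm_nonneg _) (fun n => ?_) (Summable.add hf hg)
  rw [map_add, add_mul]
  exact norm_add_le _ _

theorem evalSeries_add {f g : ℂ_[p]⟦X⟧} {z : ℂ_[p]} (hf : AbsConv f z) (hg : AbsConv g z) :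
    evalSeries (f + g) z = evalSeries f z + evalSeries g z := by
  rw [evalSeries, evalSeries, evalSeries, ← Summable.tsum_add hf.of_norm hg.of_norm]
  simp only [map_add, add_mul]

theorem evalSeries_C (c z : ℂ_[p]) : evalSeries (C c) z = c := by
  rw [evalSeries, tsum_eq_single 0]
  · simp
  · intro n hn
    simp [coeff_C, hn]

theorem AbsConv.C (c z : ℂ_[p]) : AbsConv (C c) z := by
  refine summable_of_ne_finset_zero (s := {0}) fun n hn => ?_
  simp only [Finset.mem_singleton] at hn
  simp [coeff_C, hn]

theorem evalSeries_one (z : ℂ_[p]) : evalSeries 1 z = 1 := by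
  simpa using evalSeries_C 1 z

theorem AbsConv.one (z : ℂ_[p]) : AbsConv 1 z := by
  simpa using AbsConv.C 1 z

theorem absConv_prod {ι : Type*} (s : Finset ι) {f : ι → ℂ_[p]⟦X⟧} {z : ℂ_[p]}
    (hf : ∀ i ∈ s, AbsConv (f i) z) : AbsConv (∏ i ∈ s, f i) z :=
  Finset.prod_induction f (fun f => AbsConv f z) (fun _ _ => AbsConv.mul) (AbsConv.one z) hf

theorem evalSeries_prod {ι : Type*} (s : Finset ι) {f : ι → ℂ_[p]⟦X⟧} {z : ℂ_[p]}
    (hf : ∀ i ∈ s, AbsConv (f i) z) :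
    evalSeries (∏ i ∈ s, f i) z = ∏ i ∈ s, evalSeries (f i) z := by
  classical
  induction s using Finset.induction_on with
  | empty => simp [evalSeries_one]
  | insert a s ha ih =>
    have h1 := hf a (Finset.mem_insert_self a s)
    have h2 : ∀ i ∈ s, AbsConv (f i) z := fun i hi => hf i (Finset.mem_insert_of_mem hi)
    rw [Finset.prod_insert ha, Finset.prod_insert ha, evalSeries_mul h1 (absConv_prod s h2), ih h2]

theorem norm_ofPadicInt (a : ℤ_[p]) : ‖ofPadicInt p a‖ = ‖a‖ :=
  PadicComplex.norm_extends' p (a : ℚ_[p])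

theorem norm_ofPadicInt_le_one (a : ℤ_[p]) : ‖ofPadicInt p a‖ ≤ 1 := by
  rw [norm_ofPadicInt]; exact PadicInt.norm_le_one a

theorem absConv_of_norm_coeff_le_one {f : ℂ_[p]⟦X⟧} (hf : ∀ n, ‖coeff n f‖ ≤ 1) {z : ℂ_[p]}
    (hz : ‖z‖ < 1) : AbsConv f z := by
  refine Summable.of_nonneg_of_le (fun _ => norm_nonneg _) (fun n => ?_)
    (summable_geometric_of_lt_one (norm_nonneg z) hz)
  rw [norm_mul, norm_pow]
  exact mul_le_of_le_one_left (by positivity) (hf n)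

theorem absConv_map (H : ℤ_[p]⟦X⟧) {z : ℂ_[p]} (hz : ‖z‖ < 1) :
    AbsConv (H.map (ofPadicInt p)) z :=
  absConv_of_norm_coeff_le_one (fun n => by rw [coeff_map]; exact norm_ofPadicInt_le_one _) hz

theorem evalInt_eq (H : ℤ_[p]⟦X⟧) (z : ℂ_[p]) :
    evalInt H z = evalSeries (H.map (ofPadicInt p)) z := by
  simp [evalInt, evalSeries]

/-- Evaluation of series with coefficients in `ℤ_p` at a point of the open unit disc. -/
def evalHom (z : ℂ_[p]) (hz : ‖z‖ < 1) : ℤ_[p]⟦X⟧ →+* ℂ_[p] where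
  toFun H := evalInt H z
  map_zero' := by simp [evalInt]
  map_one' := by rw [evalInt_eq, map_one, evalSeries_one]
  map_add' f g := by
    rw [evalInt_eq, map_add, evalSeries_add (absConv_map f hz) (absConv_map g hz), evalInt_eq,
      evalInt_eq]
  map_mul' f g := by
    rw [evalInt_eq, map_mul, evalSeries_mul (absConv_map f hz) (absConv_map g hz), evalInt_eq,
      evalInt_eq]

theorem evalHom_apply (z : ℂ_[p]) (hz : ‖z‖ < 1) (H : ℤ_[p]⟦X⟧) :
    evalHom z hz H = evalInt H z := rfl

theorem evalHom_C (z : ℂ_[p]) (hz : ‖z‖ < 1) (a : ℤ_[p]) :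
    evalHom z hz (C a) = ofPadicInt p a := by
  rw [evalHom_apply, evalInt_eq, map_C, evalSeries_C]

theorem evalHom_X (z : ℂ_[p]) (hz : ‖z‖ < 1) : evalHom z hz X = z := by
  rw [evalHom_apply, evalInt_eq, map_X, evalSeries, tsum_eq_single 1]
  · simp
  · intro n hn
    simp [coeff_X, hn]

theorem norm_evalInt_le (H : ℤ_[p]⟦X⟧) (hH : constantCoeff H = 0) {z : ℂ_[p]} (hz : ‖z‖ < 1) :
    ‖evalInt H z‖ ≤ ‖z‖ := by
  refine IsUltrametricDist.norm_tsum_le_of_forall_le_of_nonneg (norm_nonneg z) fun n => ?_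
  rcases n with _ | n
  · simp [hH]
  · rw [norm_mul, norm_pow, pow_succ']
    calc _ ≤ 1 * (‖z‖ * 1) := by
          gcongr
          · exact norm_ofPadicInt_le_one _
          · exact pow_le_one₀ (norm_nonneg z) hz.le
      _ = _ := by ring

theorem evalInt_subst {F : ℤ_[p]⟦X⟧} (hF : constantCoeff F = 0) (H : ℤ_[p]⟦X⟧) {z : ℂ_[p]}
    (hz : ‖z‖ < 1) : evalInt (H.subst F) z = evalInt H (evalInt F z) := by
  have hs := HasSubst.of_constantCoeff_zero' hF
  let g : ℕ → ℕ → ℂ_[p] := fun n k =>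
    ofPadicInt p (coeff n H) * (ofPadicInt p (coeff k (F ^ n)) * z ^ k)
  have hcoeff : ∀ n k, k < n → coeff k (F ^ n) = 0 := by
    intro n k hkn
    exact X_pow_dvd_iff.mp (pow_dvd_pow_of_dvd (X_dvd_iff.mpr hF) n) k hkn
  have hsum : Summable (Function.uncurry g) := by
    set r := Real.sqrt ‖z‖ with hr
    have hr1 : r < 1 := by rw [hr, Real.sqrt_lt' one_pos]; simpa using hz
    have hr0 : 0 ≤ r := Real.sqrt_nonneg _
    have hr2 : r * r = ‖z‖ := Real.mul_self_sqrt (norm_nonneg z)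
    have hgeo := summable_geometric_of_lt_one hr0 hr1
    refine Summable.of_norm_bounded (g := fun x : ℕ × ℕ => r ^ x.1 * r ^ x.2)
      (hgeo.mul_of_nonneg hgeo (fun _ => pow_nonneg hr0 _) fun _ => pow_nonneg hr0 _) ?_
    rintro ⟨n, k⟩
    simp only [Function.uncurry, g]
    by_cases hkn : k < n
    · rw [hcoeff n k hkn]
      simp only [map_zero, zero_mul, mul_zero, norm_zero]
      positivity
    · rw [norm_mul, norm_mul, norm_pow, ← hr2, mul_pow]
      calc _ ≤ 1 * (1 * (r ^ k * r ^ k)) := by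
            gcongr
            · exact norm_ofPadicInt_le_one _
            · exact norm_ofPadicInt_le_one _
        _ = r ^ k * r ^ k := by ring
        _ ≤ r ^ n * r ^ k := by
            gcongr ?_ * _
            exact pow_le_pow_of_le_one hr0 hr1.le (by omega)
  have hR : evalInt H (evalInt F z) = ∑' n, ∑' k, g n k := by
    refine tsum_congr fun n => ?_
    rw [← evalHom_apply z hz, ← map_pow, evalHom_apply, evalInt, ← tsum_mul_left]
  have hL : evalInt (H.subst F) z = ∑' k, ∑' n, g n k := by
    refine tsum_congr fun k => ?_
    rw [coeff_subst' hs, tsum_eq_sum (s := Finset.range (k + 1)),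
      finsum_eq_sum_of_support_subset (s := Finset.range (k + 1)), map_sum, Finset.sum_mul]
    · refine Finset.sum_congr rfl fun n _ => ?_
      simp only [smul_eq_mul, map_mul, g]
      ring
    · intro n hn
      by_contra hn'
      apply hn
      simp only [Finset.coe_range, Set.mem_Iio, not_lt] at hn'
      simp [hcoeff n k (by omega)]
    · intro n hn
      simp only [Finset.mem_range, not_lt] at hn
      simp [g, hcoeff n k (by omega)]
  rw [hL, hR]
  exact Summable.tsum_comm hsum

variable {F : ℤ_[p]⟦X⟧}

theorem norm_iterate_evalInt_lt_one (hF : IsLubinTate p F) {z : ℂ_[p]} (hz : ‖z‖ < 1) (n : ℕ) :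
    ‖(evalInt F)^[n] z‖ < 1 := by
  induction n with
  | zero => simpa using hz
  | succ n ih =>
    rw [Function.iterate_succ_apply']
    exact (norm_evalInt_le F hF.constantCoeff ih).trans_lt ih

theorem evalInt_iterate_compHom (hF : IsLubinTate p F) (H : ℤ_[p]⟦X⟧) {z : ℂ_[p]} (hz : ‖z‖ < 1)
    (n : ℕ) : evalInt ((compHom hF)^[n] H) z = evalInt H ((evalInt F)^[n] z) := by
  induction n generalizing H with
  | zero => rfl
  | succ n ih =>
    rw [Function.iterate_succ_apply, ih, compHom_apply, Function.iterate_succ_apply',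
      evalInt_subst hF.constantCoeff H (norm_iterate_evalInt_lt_one hF hz n)]

/-- By Weierstrass division by an iterate of `F`, the value of a power series over `ℤ_p` at a zero
of this iterate is the value of a polynomial. -/
theorem evalInt_mem_ringO (hF : IsLubinTate p F) (H : ℤ_[p]⟦X⟧) {z : ℂ_[p]} (hz : ‖z‖ < 1) {m : ℕ}
    (hm : (evalInt F)^[m + 1] z = 0) : evalInt H z ∈ ringO F := by
  have hne : ((compHom hF)^[m + 1] X).map (IsLocalRing.residue ℤ_[p]) ≠ 0 := by
    rw [map_residue_iterate_compHom]
    exact pow_ne_zero _ X_ne_zero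
  obtain ⟨q, r, hqr⟩ := exists_isWeierstrassDivision H hne
  have hzO : z ∈ ringO F := Subring.subset_closure (Or.inr ⟨hz, m, hm⟩)
  have h0 : evalHom z hz ((compHom hF)^[m + 1] X) = 0 := by
    rw [evalHom_apply, evalInt_iterate_compHom hF X hz, hm]
    rw [← evalHom_apply 0 (by simp), evalHom_X]
  rw [← evalHom_apply z hz, hqr.eq_mul_add, map_add, map_mul, h0, zero_mul, zero_add]
  clear hqr
  induction r using Polynomial.induction_on' with
  | add f g hf hg => rw [Polynomial.coe_add, map_add]; exact add_mem hf hg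
  | monomial n a =>
    have hmon : PowerSeries.monomial n a = C a * X ^ n := by
      ext; simp [coeff_X_pow, coeff_monomial]
    rw [Polynomial.coe_monomial, hmon, map_mul, map_pow, evalHom_C, evalHom_X]
    exact mul_mem (Subring.subset_closure (Or.inl ⟨a, rfl⟩)) (pow_mem hzO n)

end Evaluation

/-! ### The Witt vectors attached to a Tate generator -/

section Tate

open PowerSeries

variable {p : ℕ} [Fact p.Prime] {F : ℤ_[p]⟦X⟧} {π : ℕ → ℂ_[p]}

theorem IsTateGenerator.iterate (hF : IsLubinTate p F) (hπ : IsTateGenerator F π) (m n : ℕ) :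
    (evalInt F)^[n] (π m) = if n ≤ m then π (m - n) else 0 := by
  induction n with
  | zero => simp
  | succ n ih =>
    rw [Function.iterate_succ_apply', ih]
    split_ifs with h1 h2 h2
    · have := hπ.eval_succ (m - (n + 1))
      rwa [show m - (n + 1) + 1 = m - n by omega] at this
    · rw [show m - n = 0 by omega, hπ.eval_zero]
    · omega
    · rw [← norm_le_zero_iff]
      simpa using norm_evalInt_le F hF.constantCoeff (z := 0) (by simp)

theorem wittVector_ext_ghost {a b : WittVector p ℂ_[p]}
    (h : ∀ n, WittVector.ghostComponent n a = WittVector.ghostComponent n b) : a = b := by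
  let : Invertible (p : ℂ_[p]) :=
    invertibleOfNonzero (Nat.cast_ne_zero.mpr (Fact.out : p.Prime).ne_zero)
  exact (WittVector.ghostMap.bijective_of_invertible p ℂ_[p]).1 (funext h)

/-- The Witt vector over `ℂ_p` with ghost components `H(z), H(F(z)), H(F(F(z))), …`. -/
def dworkWitt (hF : IsLubinTate p F) (H : ℤ_[p]⟦X⟧) (z : ℂ_[p]) : WittVector p ℂ_[p] :=
  WittVector.mk p fun i => evalInt (dworkComp p (compHom hF) H i) z

theorem ghostComponent_dworkWitt (hF : IsLubinTate p F) (H : ℤ_[p]⟦X⟧) {z : ℂ_[p]} (hz : ‖z‖ < 1)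
    (n : ℕ) : WittVector.ghostComponent n (dworkWitt hF H z) =
      evalInt H ((evalInt F)^[n] z) := by
  rw [← evalInt_iterate_compHom hF H hz, ← sum_dworkComp H (dvd_compHom_sub_pow hF),
    WittVector.ghostComponent_apply, aeval_wittPolynomial, ← evalHom_apply z hz, map_sum]
  refine Finset.sum_congr rfl fun i _ => ?_
  rw [map_mul, map_pow, map_pow, map_natCast]
  rfl

theorem constantCoeff_dworkComp (hF : IsLubinTate p F) {H : ℤ_[p]⟦X⟧}
    (hH : PowerSeries.constantCoeff H = 0) (n : ℕ) :
    PowerSeries.constantCoeff (dworkComp p (compHom hF) H n) = 0 :=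
  map_dworkComp_eq_zero H (dvd_compHom_sub_pow hF) (PowerSeries.constantCoeff (R := ℤ_[p]))
    (constantCoeff_iterate_compHom hF hH) n

theorem varpi_eq_dworkWitt (hF : IsLubinTate p F) (hπ : IsTateGenerator F π) (m : ℕ) :
    varpi π m = dworkWitt hF X (π m) := by
  refine wittVector_ext_ghost fun n => ?_
  have h : ‖(evalInt F)^[n] (π m)‖ < 1 := norm_iterate_evalInt_lt_one hF (hπ.norm_lt_one m) n
  rw [ghostComponent_varpi, ghostComponent_dworkWitt hF X (hπ.norm_lt_one m), ← hπ.iterate hF,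
    ← evalHom_apply _ h, evalHom_X]

theorem coeff_varpi_mem_ringO (hF : IsLubinTate p F) (hπ : IsTateGenerator F π) (m i : ℕ) :
    (varpi π m).coeff i ∈ ringO F := by
  rw [varpi_eq_dworkWitt hF hπ]
  refine evalInt_mem_ringO hF _ (hπ.norm_lt_one m) (m := m) ?_
  rw [hπ.iterate hF, if_neg (by omega)]

theorem norm_coeff_varpi_le (hF : IsLubinTate p F) (hπ : IsTateGenerator F π) (m i : ℕ) :
    ‖(varpi π m).coeff i‖ ≤ ‖π m‖ := by
  rw [varpi_eq_dworkWitt hF hπ]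
  exact norm_evalInt_le _ (constantCoeff_dworkComp hF (by simp) i) (hπ.norm_lt_one m)

/-- Write `F = T (p + H)`. The Witt vector with ghost components `H(π_{m+1}), H(π_m), …` has
topologically nilpotent components, and its product with `ϖ_{m+1}` is `ϖ_m - p ϖ_{m+1}`. -/
theorem exists_varpi_succ_mul (hF : IsLubinTate p F) (hπ : IsTateGenerator F π) (m : ℕ) :
    ∃ v : WittVector p ℂ_[p], (∀ i, ‖v.coeff i‖ < 1) ∧
      varpi π (m + 1) * v = varpi π m - (p : WittVector p ℂ_[p]) * varpi π (m + 1) := by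
  obtain ⟨H, hH, hFH⟩ := hF.exists_eq_X_mul
  have hz := hπ.norm_lt_one (m + 1)
  refine ⟨dworkWitt hF H (π (m + 1)), fun i =>
    (norm_evalInt_le _ (constantCoeff_dworkComp hF hH i) hz).trans_lt hz, ?_⟩
  refine wittVector_ext_ghost fun n => ?_
  rw [map_mul, map_sub, map_mul, map_natCast, ghostComponent_dworkWitt hF H hz,
    ghostComponent_varpi, ghostComponent_varpi, ← hπ.iterate hF]
  have hn := norm_iterate_evalInt_lt_one hF hz n
  have h1 : (evalInt F)^[n + 1] (π (m + 1)) = if n ≤ m then π (m - n) else 0 := by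
    rw [hπ.iterate hF]
    simp
  rw [← h1, Function.iterate_succ_apply']
  have h2 : ∀ z : ℂ_[p], ‖z‖ < 1 → evalInt F z = z * (p + evalInt H z) := by
    intro z hz
    rw [← evalHom_apply z hz, hFH, map_mul, map_add, map_natCast, evalHom_X, evalHom_apply]
  rw [h2 _ hn]
  ring

theorem norm_natCast_le_norm_tate (hF : IsLubinTate p F) (hπ : IsTateGenerator F π) :
    ‖(p : ℂ_[p])‖ ≤ ‖π 0‖ := by
  obtain ⟨H, hH, hFH⟩ := hF.exists_eq_X_mul
  have hz := hπ.norm_lt_one 0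
  have h := hπ.eval_zero
  rw [← evalHom_apply _ hz, hFH, map_mul, map_add, map_natCast, evalHom_X, evalHom_apply] at h
  have h2 : (p : ℂ_[p]) = - evalInt H (π 0) :=
    eq_neg_of_add_eq_zero_left ((mul_eq_zero.mp h).resolve_left hπ.zero_ne)
  rw [h2, norm_neg]
  exact norm_evalInt_le H hH hz

end Tate

/-! ### Overconvergent series -/

section Overconvergent

open PowerSeries

variable {p : ℕ} [Fact p.Prime]

/-- The series `f` converges on a disc of radius greater than one. -/
def Overconvergent (f : ℂ_[p]⟦X⟧) : Prop :=
  ∃ ρ : ℝ, 1 < ρ ∧ ∃ M : ℝ, ∀ n, ‖coeff n f‖ * ρ ^ n ≤ M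

theorem absConv_of_norm_coeff_mul_pow_le {f : ℂ_[p]⟦X⟧} {ρ M : ℝ}
    (hf : ∀ n, ‖coeff n f‖ * ρ ^ n ≤ M) {z : ℂ_[p]} (hz : ‖z‖ < ρ) : AbsConv f z := by
  have hρ : 0 < ρ := (norm_nonneg z).trans_lt hz
  have hM : 0 ≤ M := (mul_nonneg (norm_nonneg _) (pow_nonneg hρ.le 0)).trans (hf 0)
  refine Summable.of_nonneg_of_le (fun _ => norm_nonneg _) (fun n => ?_)
    ((summable_geometric_of_lt_one (by positivity) ((div_lt_one hρ).mpr hz)).mul_left M)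
  rw [norm_mul, norm_pow, div_pow, ← mul_div_assoc, le_div_iff₀ (by positivity)]
  calc ‖coeff n f‖ * ‖z‖ ^ n * ρ ^ n = (‖coeff n f‖ * ρ ^ n) * ‖z‖ ^ n := by ring
    _ ≤ M * ‖z‖ ^ n := mul_le_mul_of_nonneg_right (hf n) (by positivity)

theorem Overconvergent.absConv {f : ℂ_[p]⟦X⟧} (hf : Overconvergent f) {z : ℂ_[p]} (hz : ‖z‖ ≤ 1) :
    AbsConv f z := by
  obtain ⟨ρ, hρ, M, hM⟩ := hf
  exact absConv_of_norm_coeff_mul_pow_le hM (hz.trans_lt hρ)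

theorem Overconvergent.one : Overconvergent (1 : ℂ_[p]⟦X⟧) := by
  refine ⟨2, by norm_num, 1, fun n => ?_⟩
  rw [coeff_one]
  split_ifs with h
  · simp [h]
  · simp

theorem Overconvergent.mul {f g : ℂ_[p]⟦X⟧} (hf : Overconvergent f) (hg : Overconvergent g) :
    Overconvergent (f * g) := by
  obtain ⟨ρ, hρ, M, hM⟩ := hf
  obtain ⟨ρ', hρ', M', hM'⟩ := hg
  have hM0 : 0 ≤ M := (mul_nonneg (norm_nonneg _) (pow_nonneg (by linarith) 0)).trans (hM 0)
  have hM0' : 0 ≤ M' := (mul_nonneg (norm_nonneg _) (pow_nonneg (by linarith) 0)).trans (hM' 0)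
  have hmin : 1 < min ρ ρ' := lt_min hρ hρ'
  refine ⟨min ρ ρ', hmin, M * M', fun n => ?_⟩
  have hpos : 0 < min ρ ρ' ^ n := by positivity
  rw [← le_div_iff₀ hpos, coeff_mul]
  refine IsUltrametricDist.norm_sum_le_of_forall_le_of_nonneg (by positivity) fun x hx => ?_
  rw [le_div_iff₀ hpos, ← Finset.HasAntidiagonal.mem_antidiagonal.mp hx, pow_add, norm_mul]
  calc _ = (‖coeff x.1 f‖ * min ρ ρ' ^ x.1) * (‖coeff x.2 g‖ * min ρ ρ' ^ x.2) := by ring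
    _ ≤ (‖coeff x.1 f‖ * ρ ^ x.1) * (‖coeff x.2 g‖ * ρ' ^ x.2) := by
        gcongr
        · exact min_le_left _ _
        · exact min_le_right _ _
    _ ≤ M * M' := mul_le_mul (hM _) (hM' _) (by positivity) hM0

theorem Overconvergent.prod {ι : Type*} (s : Finset ι) {f : ι → ℂ_[p]⟦X⟧}
    (hf : ∀ i ∈ s, Overconvergent (f i)) : Overconvergent (∏ i ∈ s, f i) :=
  Finset.prod_induction f Overconvergent (fun _ _ => Overconvergent.mul) Overconvergent.one hf

theorem Overconvergent.subst {f : ℂ_[p]⟦X⟧} (hf : Overconvergent f) {c : ℂ_[p]} (hc : ‖c‖ ≤ 1)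
    {d : ℕ} (hd : d ≠ 0) : Overconvergent (f.subst (C c * X ^ d : ℂ_[p]⟦X⟧)) := by
  obtain ⟨ρ, hρ, M, hM⟩ := hf
  have hM0 : 0 ≤ M := (mul_nonneg (norm_nonneg _) (pow_nonneg (by linarith) 0)).trans (hM 0)
  refine ⟨ρ ^ ((d : ℝ)⁻¹), Real.one_lt_rpow hρ (by positivity), M, fun n => ?_⟩
  rw [coeff_subst_C_mul_X_pow _ _ hd]
  split_ifs with h
  · obtain ⟨k, rfl⟩ := h
    rw [Nat.mul_div_cancel_left _ (Nat.pos_of_ne_zero hd), pow_mul,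
      Real.rpow_inv_natCast_pow (by linarith) hd, norm_mul, norm_pow]
    refine le_trans ?_ (hM k)
    gcongr ?_ * _
    exact mul_le_of_le_one_right (norm_nonneg _) (pow_le_one₀ (norm_nonneg _) hc)
  · simpa using hM0

theorem overconvergent_subst {f : ℂ_[p]⟦X⟧} (hf : ∀ n, ‖coeff n f‖ ≤ 1) {c : ℂ_[p]}
    (hc : ‖c‖ < 1) {d : ℕ} (hd : d ≠ 0) : Overconvergent (f.subst (C c * X ^ d : ℂ_[p]⟦X⟧)) := by
  set r := max ‖c‖ (1 / 2) with hr
  have hr1 : r < 1 := max_lt hc (by norm_num)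
  have hr0 : 0 < r := lt_of_lt_of_le (by norm_num) (le_max_right _ _)
  refine ⟨(r⁻¹) ^ ((d : ℝ)⁻¹), Real.one_lt_rpow ((one_lt_inv₀ hr0).mpr hr1) (by positivity), 1,
    fun n => ?_⟩
  rw [coeff_subst_C_mul_X_pow _ _ hd]
  split_ifs with h
  · obtain ⟨k, rfl⟩ := h
    rw [Nat.mul_div_cancel_left _ (Nat.pos_of_ne_zero hd), pow_mul,
      Real.rpow_inv_natCast_pow (by positivity) hd, norm_mul, norm_pow, inv_pow,
      ← div_eq_mul_inv, div_le_one (by positivity)]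
    calc _ ≤ 1 * r ^ k := by
          gcongr
          · exact hf k
          · exact le_max_left _ _
      _ = r ^ k := one_mul _
  · simp

theorem evalSeries_subst (f : ℂ_[p]⟦X⟧) (c : ℂ_[p]) {d : ℕ} (hd : d ≠ 0) (z : ℂ_[p]) :
    evalSeries (f.subst (C c * X ^ d : ℂ_[p]⟦X⟧)) z = evalSeries f (c * z ^ d) := by
  have hinj : Function.Injective fun k : ℕ => d * k :=
    fun _ _ h => Nat.eq_of_mul_eq_mul_left (Nat.pos_of_ne_zero hd) h
  rw [evalSeries, ← hinj.tsum_eq, evalSeries]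
  · refine tsum_congr fun k => ?_
    rw [coeff_subst_C_mul_X_pow _ _ hd, if_pos (dvd_mul_right _ _),
      Nat.mul_div_cancel_left _ (Nat.pos_of_ne_zero hd), mul_pow, ← pow_mul]
    ring
  · intro n hn
    by_contra h
    apply hn
    change coeff n _ * z ^ n = 0
    rw [coeff_subst_C_mul_X_pow _ _ hd, if_neg, zero_mul]
    rintro ⟨k, rfl⟩
    exact h ⟨k, rfl⟩

theorem norm_evalSeries_le {f : ℂ_[p]⟦X⟧} {r : ℝ} (hf : ∀ n, ‖coeff n f‖ ≤ r) {z : ℂ_[p]}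
    (hz : ‖z‖ ≤ 1) : ‖evalSeries f z‖ ≤ r := by
  have hr : 0 ≤ r := (norm_nonneg _).trans (hf 0)
  refine IsUltrametricDist.norm_tsum_le_of_forall_le_of_nonneg hr fun n => ?_
  rw [norm_mul, norm_pow]
  calc _ ≤ r * 1 := by
        gcongr
        · exact hf n
        · exact pow_le_one₀ (norm_nonneg _) hz
    _ = r := mul_one r

/-- The series `f` is congruent to `1` modulo the ideal `{z | ‖z‖ ≤ r}`. -/
def OneMod (r : ℝ) (f : ℂ_[p]⟦X⟧) : Prop := coeff 0 f = 1 ∧ ∀ n ≠ 0, ‖coeff n f‖ ≤ r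

theorem OneMod.norm_coeff_le_one {r : ℝ} (hr : r ≤ 1) {f : ℂ_[p]⟦X⟧} (hf : OneMod r f) (n : ℕ) :
    ‖coeff n f‖ ≤ 1 := by
  rcases eq_or_ne n 0 with rfl | hn
  · simp [hf.1]
  · exact (hf.2 n hn).trans hr

theorem OneMod.one {r : ℝ} (hr : 0 ≤ r) : OneMod r (1 : ℂ_[p]⟦X⟧) :=
  ⟨by simp, fun n hn => by simpa [coeff_one, hn] using hr⟩

theorem OneMod.mul {r : ℝ} (hr : r ≤ 1) {f g : ℂ_[p]⟦X⟧} (hf : OneMod r f) (hg : OneMod r g) :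
    OneMod r (f * g) := by
  have hf1 := hf.norm_coeff_le_one hr
  have hg1 := hg.norm_coeff_le_one hr
  refine ⟨?_, fun n hn => ?_⟩
  · rw [coeff_mul, Finset.HasAntidiagonal.antidiagonal_zero]
    simp only [Finset.sum_singleton, hf.1, hg.1, mul_one]
  · have hr0 : 0 ≤ r := (norm_nonneg _).trans (hf.2 n hn)
    rw [coeff_mul]
    refine IsUltrametricDist.norm_sum_le_of_forall_le_of_nonneg hr0 fun x hx => ?_
    have hx' := Finset.HasAntidiagonal.mem_antidiagonal.mp hx
    rw [norm_mul]
    rcases eq_or_ne x.1 0 with h | h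
    · exact (mul_le_mul (hf1 _) (hg.2 x.2 (by omega)) (norm_nonneg _) zero_le_one).trans
        (one_mul r).le
    · exact (mul_le_mul (hf.2 _ h) (hg1 _) (norm_nonneg _) hr0).trans (mul_one r).le

theorem OneMod.norm_evalSeries_sub_one_le {r : ℝ} {f : ℂ_[p]⟦X⟧} (hf : OneMod r f) {z : ℂ_[p]}
    (hc : AbsConv f z) (hz : ‖z‖ ≤ 1) : ‖evalSeries f z - 1‖ ≤ r := by
  have hr0 : 0 ≤ r := (norm_nonneg _).trans (hf.2 1 one_ne_zero)
  have h : evalSeries f z - 1 = evalSeries (f + C (-1)) z := by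
    rw [evalSeries_add hc (AbsConv.C _ _), evalSeries_C, sub_eq_add_neg]
  rw [h]
  refine norm_evalSeries_le (fun n => ?_) hz
  rcases eq_or_ne n 0 with rfl | hn
  · rw [map_add, hf.1]; simpa using hr0
  · rw [map_add, coeff_C, if_neg hn, add_zero]; exact hf.2 n hn

end Overconvergent

/-! ### Coefficients of Artin-Hasse exponentials -/

section Coefficients

open PowerSeries

variable {p : ℕ} [Fact p.Prime]

theorem coeff_artinHasseAt (a : ℂ_[p]) {d : ℕ} (hd : d ≠ 0) :
    ∃ A : ℕ → ℤ_[p], ∀ n, coeff n (artinHasseAt a d) =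
      if d ∣ n then ofPadicInt p (A (n / d)) * a ^ (n / d) else 0 := by
  obtain ⟨A, hA⟩ := exists_map_eq_artinHasse (p := p)
  refine ⟨fun n => coeff n A, fun n => ?_⟩
  rw [artinHasseAt, ← hA, coeff_subst_C_mul_X_pow _ _ hd]
  simp

theorem coeff_zero_artinHasseAt (a : ℂ_[p]) (i : ℕ) : coeff 0 (artinHasseAt a (p ^ i)) = 1 := by
  rw [artinHasseAt_pow, coeff_zero_eq_constantCoeff_apply, constantCoeff_ghostExp]

theorem oneMod_artinHasseMap {r : ℝ} (hr : r ≤ 1) {a : WittVector p ℂ_[p]}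
    (ha : ∀ i, ‖a.coeff i‖ ≤ r) : OneMod r (artinHasseMap a) := by
  have hr0 : 0 ≤ r := (norm_nonneg _).trans (ha 0)
  have h : ∀ n, OneMod r (∏ i ∈ Finset.range (n + 1), artinHasseAt (a.coeff i) (p ^ i)) := by
    intro n
    refine Finset.prod_induction _ (OneMod r) (fun _ _ => OneMod.mul hr) (OneMod.one hr0) ?_
    intro i _
    refine ⟨coeff_zero_artinHasseAt _ _, fun n hn => ?_⟩
    obtain ⟨A, hA⟩ := coeff_artinHasseAt (a.coeff i) (d := p ^ i)
      (pow_ne_zero _ (Fact.out : p.Prime).ne_zero)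
    rw [hA]
    split_ifs with hdvd
    · rw [norm_mul, norm_pow]
      have hk : n / p ^ i ≠ 0 := by
        obtain ⟨k, rfl⟩ := hdvd
        rw [Nat.mul_div_cancel_left _ (pow_pos (Fact.out : p.Prime).pos _)]
        rintro rfl
        exact hn (mul_zero _)
      calc _ ≤ 1 * ‖a.coeff i‖ := by
            gcongr
            · exact norm_ofPadicInt_le_one _
            · exact pow_le_of_le_one (norm_nonneg _) ((ha i).trans hr) hk
        _ ≤ r := by rw [one_mul]; exact ha i
    · simpa using hr0
  exact ⟨by rw [artinHasseMap, coeff_mk]; exact (h 0).1,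
    fun n hn => by rw [artinHasseMap, coeff_mk]; exact (h n).2 n hn⟩

/-- The series with coefficients in the subring `R`. -/
def seriesOver (R : Subring ℂ_[p]) : Subring ℂ_[p]⟦X⟧ := (PowerSeries.map R.subtype).range

theorem mem_seriesOver {R : Subring ℂ_[p]} {f : ℂ_[p]⟦X⟧} :
    f ∈ seriesOver R ↔ ∀ n, coeff n f ∈ R := by
  constructor
  · rintro ⟨g, rfl⟩ n
    rw [coeff_map]
    exact (coeff n g).2
  · intro h
    refine ⟨PowerSeries.mk fun n => (⟨coeff n f, h n⟩ : R), ?_⟩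
    ext n
    rw [coeff_map, coeff_mk]
    rfl

theorem inv_mem_seriesOver {R : Subring ℂ_[p]} {f : ℂ_[p]⟦X⟧} (hf : f ∈ seriesOver R)
    (h1 : constantCoeff f = 1) : f⁻¹ ∈ seriesOver R := by
  obtain ⟨g, rfl⟩ := hf
  have hg : constantCoeff g = 1 := by
    apply Subtype.coe_injective
    rw [← coeff_zero_eq_constantCoeff_apply, coeff_map] at h1
    simpa using h1
  refine ⟨invOfUnit g 1, ?_⟩
  symm
  rw [PowerSeries.inv_eq_iff_mul_eq_one (by rw [h1]; exact one_ne_zero), ← map_mul, mul_comm,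
    mul_invOfUnit _ _ (by rw [hg]; rfl), map_one]

theorem subst_mem_seriesOver {R : Subring ℂ_[p]} {f : ℂ_[p]⟦X⟧} (hf : f ∈ seriesOver R)
    {c : ℂ_[p]} (hc : c ∈ R) {d : ℕ} (hd : d ≠ 0) :
    f.subst (C c * X ^ d : ℂ_[p]⟦X⟧) ∈ seriesOver R := by
  rw [mem_seriesOver] at hf ⊢
  intro n
  rw [coeff_subst_C_mul_X_pow _ _ hd]
  split_ifs
  · exact mul_mem (hf _) (pow_mem hc _)
  · exact zero_mem R

theorem artinHasseMap_mem_seriesOver {R : Subring ℂ_[p]} (hR : (ofPadicInt p).range ≤ R)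
    {a : WittVector p ℂ_[p]} (ha : ∀ i, a.coeff i ∈ R) : artinHasseMap a ∈ seriesOver R := by
  rw [mem_seriesOver]
  intro n
  rw [artinHasseMap, coeff_mk]
  refine mem_seriesOver.mp (prod_mem fun i _ => mem_seriesOver.mpr fun k => ?_) n
  obtain ⟨A, hA⟩ := coeff_artinHasseAt (a.coeff i) (d := p ^ i)
    (pow_ne_zero _ (Fact.out : p.Prime).ne_zero)
  rw [hA]
  split_ifs
  · exact mul_mem (hR ⟨_, rfl⟩) (pow_mem (ha i) _)
  · exact zero_mem R

end Coefficients

/-! ### Overconvergence of the Pulita exponentials -/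

section Pulita

open PowerSeries

variable {p : ℕ} [Fact p.Prime] {F : ℤ_[p]⟦X⟧} {π : ℕ → ℂ_[p]}

omit [Fact p.Prime] in
theorem ghostShift_ghostShift_one {K : Type*} [Field K] (i j : ℕ) (c : K) (w : ℕ → K) :
    ghostShift p j c (ghostShift p i 1 w) = ghostShift p i 1 (ghostShift p j (c ^ p ^ i) w) := by
  ext n
  simp only [ghostShift, one_pow, mul_one]
  by_cases h : i + j ≤ n
  · rw [if_pos (by omega), if_pos (by omega), if_pos (by omega), if_pos (by omega), ← pow_mul,
      ← pow_add, show i + (n - i - j) = n - j by omega, show n - j - i = n - i - j by omega]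
    ring
  · split_ifs <;> first | omega | simp

omit [Fact p.Prime] in
theorem ghostShift_one_add {K : Type*} [Field K] (i j : ℕ) (w : ℕ → K) :
    ghostShift p i 1 (ghostShift p j 1 w) = ghostShift p (i + j) 1 w := by
  ext n
  simp only [ghostShift, one_pow, mul_one]
  by_cases h : i + j ≤ n
  · rw [if_pos (by omega), if_pos (by omega), if_pos h, Nat.sub_sub, pow_add]
    ring
  · split_ifs <;> first | omega | simp

omit [Fact p.Prime] in
theorem ghostShift_sub {K : Type*} [Field K] (j : ℕ) (c : K) (w w' : ℕ → K) :
    ghostShift p j c (w - w') = ghostShift p j c w - ghostShift p j c w' := by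
  ext n
  simp only [ghostShift, Pi.sub_apply]
  split_ifs
  · ring
  · simp

/-- The ghost components of `ϖ_m`. -/
def ghostVarpi (π : ℕ → ℂ_[p]) (m n : ℕ) : ℂ_[p] := if n ≤ m then π (m - n) else 0

theorem artinHasseMap_varpi (m : ℕ) :
    artinHasseMap (varpi π m) = ghostExp p (ghostVarpi π m) := by
  rw [artinHasseMap_eq_ghostExp]
  simp only [ghostComponent_varpi]
  rfl

theorem substPow_ghostExp (i : ℕ) (w : ℕ → ℂ_[p]) :
    substPow (p ^ i) (ghostExp p w) = ghostExp p (ghostShift p i 1 w) := by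
  rw [substPow_eq, ghostExp_subst]

theorem substPow_one_ghostExp (w : ℕ → ℂ_[p]) :
    substPow p (ghostExp p w) = ghostExp p (ghostShift p 1 1 w) := by
  rw [← substPow_ghostExp, pow_one]

theorem inv_ghostExp (w : ℕ → ℂ_[p]) : (ghostExp p w)⁻¹ = ghostExp p (-w) := by
  rw [PowerSeries.inv_eq_iff_mul_eq_one (by rw [constantCoeff_ghostExp]; exact one_ne_zero),
    mul_comm, ghostExp_mul_neg]

theorem pulitaExp_one (φ : ℂ_[p] →+* ℂ_[p]) (m : ℕ) :
    pulitaExp φ π m 1 =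
      ghostExp p (ghostVarpi π m - ghostShift p 1 1 (ghostVarpi π m)) := by
  rw [pulitaExp, map_one, mul_one, artinHasseMap_varpi, substPow_one_ghostExp, inv_ghostExp,
    ← ghostExp_add, sub_eq_add_neg]

/-- The product defining `θ_{m,s}(1)` telescopes to `E(ϖ_m)(x) / E(ϖ_m)(x ^ q)`. -/
theorem pulitaExpGen_one (φ : ℂ_[p] →+* ℂ_[p]) (m s : ℕ) :
    pulitaExpGen φ π m s 1 =
      ghostExp p (ghostVarpi π m - ghostShift p s 1 (ghostVarpi π m)) := by
  have h : ∀ i, ghostShift p i 1 (ghostVarpi π m - ghostShift p 1 1 (ghostVarpi π m)) =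
      ghostShift p i 1 (ghostVarpi π m) - ghostShift p (i + 1) 1 (ghostVarpi π m) := by
    intro i
    rw [ghostShift_sub, ghostShift_one_add]
  rw [pulitaExpGen]
  simp only [map_one, pulitaExp_one, substPow_ghostExp, h]
  rw [← ghostExp_sum, Finset.sum_range_sub']
  congr 2
  ext n
  simp [ghostShift]

/-- As the ghost components of `ϖ_M` of index greater than `M` vanish, `ϖ_M · a` only depends on the
first `M + 1` components of `a`, and its Artin-Hasse exponential is a finite product. -/
theorem artinHasseMap_varpi_mul (M : ℕ) (a : WittVector p ℂ_[p]) :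
    artinHasseMap (varpi π M * a) = ∏ j ∈ Finset.range (M + 1),
      (artinHasseMap (varpi π (M - j))).subst
        (C (a.coeff j) * X ^ p ^ j : ℂ_[p]⟦X⟧) := by
  simp only [artinHasseMap_varpi, ghostExp_subst]
  rw [← ghostExp_sum, artinHasseMap_eq_ghostExp]
  congr 1
  ext n
  rw [map_mul, ghostComponent_varpi, Finset.sum_apply, WittVector.ghostComponent_apply,
    aeval_wittPolynomial]
  split_ifs with h
  · rw [Finset.mul_sum]
    refine Finset.sum_subset_zero_on_sdiff (Finset.range_mono (by omega)) ?_ ?_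
    · intro j hj
      simp only [Finset.mem_sdiff, Finset.mem_range] at hj
      rw [ghostShift, if_neg (by omega)]
    · intro j hj
      simp only [Finset.mem_range] at hj
      rw [ghostShift, if_pos (by omega), ghostVarpi, if_pos (by omega),
        show M - j - (n - j) = M - n by omega]
      ring
  · rw [zero_mul]
    refine (Finset.sum_eq_zero fun j hj => ?_).symm
    simp only [Finset.mem_range] at hj
    rw [ghostShift]
    split_ifs
    · rw [ghostVarpi, if_neg (by omega), mul_zero]
    · rfl

theorem oneMod_artinHasseMap_varpi (hF : IsLubinTate p F) (hπ : IsTateGenerator F π) (m : ℕ) :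
    OneMod ‖π m‖ (artinHasseMap (varpi π m)) :=
  oneMod_artinHasseMap (hπ.norm_lt_one m).le (norm_coeff_varpi_le hF hπ m)

theorem norm_coeff_artinHasseMap_varpi_le_one (hF : IsLubinTate p F) (hπ : IsTateGenerator F π)
    (m n : ℕ) : ‖coeff n (artinHasseMap (varpi π m))‖ ≤ 1 :=
  (oneMod_artinHasseMap_varpi hF hπ m).norm_coeff_le_one (hπ.norm_lt_one m).le n

/-- Only the components of `a` of index at most `M` contribute to `E(ϖ_M a)`. -/
theorem overconvergent_artinHasseMap_varpi_mul (hF : IsLubinTate p F) (hπ : IsTateGenerator F π)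
    {M : ℕ} {a : WittVector p ℂ_[p]} (ha : ∀ j ≤ M, ‖a.coeff j‖ < 1) :
    Overconvergent (artinHasseMap (varpi π M * a)) := by
  rw [artinHasseMap_varpi_mul]
  refine Overconvergent.prod _ fun j hj => ?_
  exact overconvergent_subst (norm_coeff_artinHasseMap_varpi_le_one hF hπ _)
    (ha j (by simpa [Nat.lt_succ_iff] using hj)) (pow_ne_zero _ (Fact.out : p.Prime).ne_zero)

theorem norm_coeff_exp_le {n : ℕ} (hn : n ≠ 0) :
    ‖coeff n (ghostExp p (Pi.single 0 (p : ℂ_[p])))‖ ≤ ‖(p : ℂ_[p])‖ := by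
  have h := norm_pow_div_factorial_le p hn
  have hN : ∀ x : ℚ_[p], ‖algebraMap ℚ_[p] ℂ_[p] x‖ = ‖x‖ := PadicComplex.norm_extends' p
  rw [← hN, ← hN] at h
  rw [coeff_ghostExp_single]
  simpa using h

theorem norm_natCast_lt_one : ‖(p : ℂ_[p])‖ < 1 := by
  have h := Padic.norm_p_lt_one (p := p)
  have hN : ∀ x : ℚ_[p], ‖algebraMap ℚ_[p] ℂ_[p] x‖ = ‖x‖ := PadicComplex.norm_extends' p
  rw [← hN] at h
  simpa using h

theorem norm_coeff_exp_le_one (n : ℕ) : ‖coeff n (ghostExp p (Pi.single 0 (p : ℂ_[p])))‖ ≤ 1 := by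
  rcases eq_or_ne n 0 with rfl | hn
  · simp [constantCoeff_ghostExp]
  · exact (norm_coeff_exp_le hn).trans norm_natCast_lt_one.le

/-- The comparison of `θ_m(1)` with `ϖ_{m+1}`: since `V ϖ_m` and `p ϖ_{m+1}` have the same ghost
components up to the first one, `ϖ_m - V ϖ_m` is, up to the first ghost component,
`ϖ_m - p ϖ_{m+1} = ϖ_{m+1} v`. -/
theorem pulitaExp_one_eq (φ : ℂ_[p] →+* ℂ_[p]) (m : ℕ) {v : WittVector p ℂ_[p]}
    (hv : varpi π (m + 1) * v = varpi π m - (p : WittVector p ℂ_[p]) * varpi π (m + 1)) :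
    pulitaExp φ π m 1 =
      (ghostExp p (Pi.single 0 (p : ℂ_[p]))).subst (C (π (m + 1)) * X ^ p ^ 0 : ℂ_[p]⟦X⟧) *
        artinHasseMap (varpi π (m + 1) * v) := by
  rw [hv, pulitaExp_one, artinHasseMap_eq_ghostExp, ghostExp_subst, ← ghostExp_add]
  congr 1
  ext n
  simp only [map_sub, map_mul, map_natCast, ghostComponent_varpi, Pi.add_apply, Pi.sub_apply,
    ghostVarpi, ghostShift]
  rcases n with _ | n
  · simp
    ring
  · simp

theorem overconvergent_pulitaExp (hF : IsLubinTate p F) (hπ : IsTateGenerator F π)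
    (φ : ℂ_[p] →+* ℂ_[p]) (m : ℕ) : Overconvergent (pulitaExp φ π m 1) := by
  obtain ⟨v, hv, h⟩ := exists_varpi_succ_mul hF hπ m
  rw [pulitaExp_one_eq φ m h]
  exact (overconvergent_subst norm_coeff_exp_le_one (hπ.norm_lt_one _) (by simp)).mul
    (overconvergent_artinHasseMap_varpi_mul hF hπ fun j _ => hv j)

theorem overconvergent_pulitaExpGen (hF : IsLubinTate p F) (hπ : IsTateGenerator F π)
    (φ : ℂ_[p] →+* ℂ_[p]) (m s : ℕ) : Overconvergent (pulitaExpGen φ π m s 1) := by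
  rw [pulitaExpGen]
  refine Overconvergent.prod _ fun i _ => ?_
  rw [map_one, substPow_eq]
  exact (overconvergent_pulitaExp hF hπ φ m).subst (by simp)
    (pow_ne_zero _ (Fact.out : p.Prime).ne_zero)

theorem range_ofPadicInt_le_ringO : (ofPadicInt p).range ≤ ringO F := by
  rintro _ ⟨a, rfl⟩
  exact Subring.subset_closure (Or.inl ⟨a, rfl⟩)

theorem pulitaExpGen_mem_seriesOver (hF : IsLubinTate p F) (hπ : IsTateGenerator F π)
    (φ : ℂ_[p] →+* ℂ_[p]) (m s : ℕ) : pulitaExpGen φ π m s 1 ∈ seriesOver (ringO F) := by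
  have he : artinHasseMap (varpi π m) ∈ seriesOver (ringO F) :=
    artinHasseMap_mem_seriesOver range_ofPadicInt_le_ringO (coeff_varpi_mem_ringO hF hπ m)
  rw [pulitaExpGen]
  refine prod_mem fun i _ => ?_
  rw [map_one, substPow_eq]
  refine subst_mem_seriesOver ?_ (one_mem _) (pow_ne_zero _ (Fact.out : p.Prime).ne_zero)
  rw [pulitaExp, map_one, mul_one]
  refine mul_mem he (inv_mem_seriesOver ?_ ?_)
  · rw [substPow_eq]
    exact subst_mem_seriesOver he (one_mem _) (Fact.out : p.Prime).ne_zero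
  · rw [artinHasseMap_varpi, substPow_one_ghostExp, constantCoeff_ghostExp]

end Pulita

/-! ### First-order expansion of the Pulita exponentials of level one -/

section FirstOrder

open PowerSeries

variable {p : ℕ} [Fact p.Prime] {F : ℤ_[p]⟦X⟧} {π : ℕ → ℂ_[p]}

theorem norm_mul_sub_mul_lt {x x' y y' : ℂ_[p]} {ε : ℝ} (hx : ‖x - x'‖ < ε) (hy : ‖y - y'‖ < ε)
    (hx1 : ‖x‖ ≤ 1) (hy1 : ‖y'‖ ≤ 1) : ‖x * y - x' * y'‖ < ε := by
  rw [show x * y - x' * y' = x * (y - y') + (x - x') * y' by ring]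
  refine (IsUltrametricDist.norm_add_le_max _ _).trans_lt (max_lt ?_ ?_)
  · rw [norm_mul]
    exact (mul_le_of_le_one_left (norm_nonneg _) hx1).trans_lt hy
  · rw [norm_mul]
    exact (mul_le_of_le_one_right (norm_nonneg _) hy1).trans_lt hx

theorem norm_le_one_of_norm_sub_lt {x y : ℂ_[p]} (hy : ‖y‖ ≤ 1) (h : ‖x - y‖ < 1) : ‖x‖ ≤ 1 := by
  rw [show x = (x - y) + y by ring]
  exact (IsUltrametricDist.norm_add_le_max _ _).trans (max_le h.le hy)

theorem norm_one_add_le_one {x : ℂ_[p]} (hx : ‖x‖ ≤ 1) : ‖1 + x‖ ≤ 1 :=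
  (IsUltrametricDist.norm_add_le_max _ _).trans (max_le (by simp) hx)

/-- On the closed unit disc, `θ_0(1)(u)` is congruent to `1 + π_0 u` modulo elements of norm
smaller than that of `π_0`. -/
theorem norm_evalSeries_pulitaExp_zero_sub_lt (hF : IsLubinTate p F) (hπ : IsTateGenerator F π)
    (φ : ℂ_[p] →+* ℂ_[p]) {u : ℂ_[p]} (hu : ‖u‖ ≤ 1) :
    ‖evalSeries (pulitaExp φ π 0 1) u - (1 + π 0 * u)‖ < ‖π 0‖ := by
  obtain ⟨v, hv, hv2⟩ := exists_varpi_succ_mul hF hπ 0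
  have hp0 : p ≠ 0 := (Fact.out : p.Prime).ne_zero
  have hpos : 0 < ‖π 0‖ := norm_pos_iff.mpr hπ.zero_ne
  have hpπ : ‖(p : ℂ_[p])‖ ≤ ‖π 0‖ := norm_natCast_le_norm_tate hF hπ
  have hlt : ‖(p : ℂ_[p])‖ * ‖π 1‖ < ‖π 0‖ := by
    have := hπ.norm_lt_one 1
    nlinarith [norm_nonneg (p : ℂ_[p]), norm_nonneg (π 1)]
  -- the first component of `v` satisfies `π_1 v_0 = π_0 - p π_1`
  have hv0 : π 1 * v.coeff 0 = π 0 - p * π 1 := by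
    have h := congrArg (WittVector.ghostComponent 0) hv2
    simp only [map_sub, map_mul, map_natCast, ghostComponent_varpi] at h
    simpa [WittVector.ghostComponent_apply] using h
  have hnv0 : ‖π 1‖ * ‖v.coeff 0‖ = ‖π 0‖ := by
    rw [← norm_mul, hv0]
    rw [← norm_mul] at hlt
    rw [sub_eq_add_neg, IsUltrametricDist.norm_add_eq_max_of_norm_ne_norm, norm_neg,
      max_eq_left hlt.le]
    rw [norm_neg]
    exact hlt.ne'
  set A := (ghostExp p (Pi.single 0 (p : ℂ_[p]))).subst (C (π 1) * X ^ p ^ 0 : ℂ_[p]⟦X⟧) with hA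
  set B := (artinHasseMap (varpi π 1)).subst (C (v.coeff 0) * X ^ p ^ 0 : ℂ_[p]⟦X⟧) with hB
  set D := (artinHasseMap (varpi π 0)).subst (C (v.coeff 1) * X ^ p ^ 1 : ℂ_[p]⟦X⟧) with hD
  have hAo : Overconvergent A :=
    overconvergent_subst norm_coeff_exp_le_one (hπ.norm_lt_one _) (by simp)
  have hBo : Overconvergent B :=
    overconvergent_subst (norm_coeff_artinHasseMap_varpi_le_one hF hπ 1) (hv 0) (by simp)
  have hDo : Overconvergent D :=
    overconvergent_subst (norm_coeff_artinHasseMap_varpi_le_one hF hπ 0) (hv 1) (by simpa)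
  have hfac : pulitaExp φ π 0 1 = A * (B * D) := by
    rw [pulitaExp_one_eq φ 0 hv2, artinHasseMap_varpi_mul, Finset.prod_range_succ,
      Finset.prod_range_succ, Finset.prod_range_zero, one_mul]
  have hAu : ‖evalSeries A u - 1‖ < ‖π 0‖ := by
    refine lt_of_le_of_lt (OneMod.norm_evalSeries_sub_one_le ⟨?_, fun n hn => ?_⟩
      (hAo.absConv hu) hu) hlt
    · rw [hA, coeff_subst_C_mul_X_pow _ _ (by simp)]
      simp [constantCoeff_ghostExp]
    · rw [hA, coeff_subst_C_mul_X_pow _ _ (by simp)]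
      simp only [pow_zero, one_dvd, if_true, Nat.div_one, norm_mul, norm_pow]
      gcongr
      · exact norm_coeff_exp_le hn
      · exact pow_le_of_le_one (norm_nonneg _) (hπ.norm_lt_one 1).le hn
  have hDu : ‖evalSeries D u - 1‖ < ‖π 0‖ := by
    have hlt1 : ‖π 0‖ * ‖v.coeff 1‖ < ‖π 0‖ := mul_lt_of_lt_one_right hpos (hv 1)
    refine lt_of_le_of_lt (OneMod.norm_evalSeries_sub_one_le ⟨?_, fun n hn => ?_⟩
      (hDo.absConv hu) hu) hlt1
    · rw [hD, coeff_subst_C_mul_X_pow _ _ (by simpa)]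
      simpa using (oneMod_artinHasseMap_varpi hF hπ 0).1
    · rw [hD, coeff_subst_C_mul_X_pow _ _ (by simpa), pow_one]
      split_ifs with hd
      · have hk : n / p ≠ 0 := by
          obtain ⟨k, rfl⟩ := hd
          rw [Nat.mul_div_cancel_left _ (Nat.pos_of_ne_zero hp0)]
          rintro rfl
          exact hn (mul_zero _)
        rw [norm_mul, norm_pow]
        gcongr
        · exact (oneMod_artinHasseMap_varpi hF hπ 0).2 _ hk
        · exact pow_le_of_le_one (norm_nonneg _) (hv 1).le hk
      · rw [norm_zero]; positivity
  have hBu : ‖evalSeries B u - (1 + π 0 * u)‖ < ‖π 0‖ := by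
    -- the terms of degree at most one of `B` are `1 + (π_0 - p π_1) X`
    have hB1 : ‖evalSeries (B + C (-1) + (C (-(π 0 - p * π 1)) * X : ℂ_[p]⟦X⟧)) u‖ ≤
        ‖π 0‖ * ‖v.coeff 0‖ := by
      refine norm_evalSeries_le (fun n => ?_) hu
      rw [map_add, map_add, coeff_C, coeff_C_mul, coeff_X, hB,
        coeff_subst_C_mul_X_pow _ _ (by simp)]
      simp only [pow_zero, one_dvd, if_true, Nat.div_one]
      rcases n with _ | _ | n
      · rw [(oneMod_artinHasseMap_varpi hF hπ 1).1]
        simp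
        positivity
      · have h1 : coeff 1 (artinHasseMap (varpi π 1)) = π 1 := by
          rw [artinHasseMap_varpi, show ghostVarpi π 1 = Pi.single 0 (π 1) +
            ghostShift p 1 1 (fun n => ghostVarpi π 0 n / p) from ?_, ghostExp_add,
            ← ghostExp_subst, coeff_mul]
          · have hap : Finset.HasAntidiagonal.antidiagonal 1 = {((0, 1) : ℕ × ℕ), (1, 0)} := rfl
            rw [hap, Finset.sum_pair (by simp)]
            simp only [coeff_ghostExp_single]
            rw [coeff_subst_C_mul_X_pow _ _ (by simpa), coeff_subst_C_mul_X_pow _ _ (by simpa),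
              if_neg (by simpa using (Fact.out : p.Prime).ne_one)]
            simp [constantCoeff_ghostExp]
          · ext n
            have hpC : (p : ℂ_[p]) ≠ 0 := Nat.cast_ne_zero.mpr hp0
            rcases n with _ | n
            · simp [ghostVarpi, ghostShift]
            · simp [ghostVarpi, ghostShift]
              field_simp
        simp only [zero_add, h1, pow_one, hv0]
        simp
        positivity
      · simp only [show n + 1 + 1 ≠ 0 by omega, show n + 1 + 1 ≠ 1 by omega, if_false, mul_zero,
          add_zero, norm_mul, norm_pow]
        calc _ ≤ ‖π 1‖ * ‖v.coeff 0‖ ^ 2 := by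
              gcongr ?_ * ?_
              · exact (oneMod_artinHasseMap_varpi hF hπ 1).2 _ (by omega)
              · exact pow_le_pow_of_le_one (norm_nonneg _) (hv 0).le (by omega)
          _ = ‖π 0‖ * ‖v.coeff 0‖ := by rw [← hnv0]; ring
    have hX : ∀ c : ℂ_[p], AbsConv (C c * X : ℂ_[p]⟦X⟧) u ∧
        evalSeries (C c * X : ℂ_[p]⟦X⟧) u = c * u := by
      intro c
      constructor
      · refine summable_of_ne_finset_zero (s := {1}) fun n hn => ?_
        simp only [Finset.mem_singleton] at hn
        simp [coeff_X, hn]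
      · rw [evalSeries, tsum_eq_single 1]
        · simp
        · intro n hn
          simp [coeff_X, hn]
    rw [evalSeries_add ((hBo.absConv hu).add (AbsConv.C _ _)) (hX _).1,
      evalSeries_add (hBo.absConv hu) (AbsConv.C _ _), evalSeries_C, (hX _).2] at hB1
    rw [show evalSeries B u - (1 + π 0 * u) =
      (evalSeries B u + -1 + -(π 0 - p * π 1) * u) + -(p * π 1 * u) by ring]
    refine (IsUltrametricDist.norm_add_le_max _ _).trans_lt (max_lt ?_ ?_)
    · exact hB1.trans_lt (mul_lt_of_lt_one_right hpos (hv 0))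
    · rw [norm_neg, norm_mul, norm_mul]
      exact (mul_le_of_le_one_right (by positivity) hu).trans_lt hlt
  have hπu : ‖1 + π 0 * u‖ ≤ 1 := norm_one_add_le_one (by
    rw [norm_mul]
    exact mul_le_one₀ (hπ.norm_lt_one 0).le (norm_nonneg _) hu)
  rw [hfac, evalSeries_mul (hAo.absConv hu) ((hBo.mul hDo).absConv hu),
    evalSeries_mul (hBo.absConv hu) (hDo.absConv hu),
    show (1 + π 0 * u) = 1 * ((1 + π 0 * u) * 1) by ring]
  have hπ1 := hπ.norm_lt_one 0
  refine norm_mul_sub_mul_lt hAu (norm_mul_sub_mul_lt hBu hDu ?_ (by simp)) ?_ (by simpa using hπu)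
  · exact norm_le_one_of_norm_sub_lt hπu (hBu.trans hπ1)
  · exact norm_le_one_of_norm_sub_lt (by simp) (hAu.trans hπ1)

/-- The first-order expansion of `θ_{0,s}(1)`: those of the factors `θ_0(1)(u ^ (p ^ i))` add up. -/
theorem norm_evalSeries_pulitaExpGen_zero_sub_lt (hF : IsLubinTate p F) (hπ : IsTateGenerator F π)
    (φ : ℂ_[p] →+* ℂ_[p]) (s : ℕ) {u : ℂ_[p]} (hu : ‖u‖ ≤ 1) :
    ‖evalSeries (pulitaExpGen φ π 0 s 1) u - (1 + π 0 * ∑ i ∈ Finset.range s, u ^ p ^ i)‖ <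
      ‖π 0‖ := by
  have hpos : 0 < ‖π 0‖ := norm_pos_iff.mpr hπ.zero_ne
  have hπ1 := hπ.norm_lt_one 0
  have hpi : ∀ i, p ^ i ≠ 0 := fun i => pow_ne_zero _ (Fact.out : p.Prime).ne_zero
  have hui : ∀ i, ‖u ^ p ^ i‖ ≤ 1 := fun i => by
    rw [norm_pow]; exact pow_le_one₀ (norm_nonneg _) hu
  rw [pulitaExpGen]
  simp only [map_one]
  simp only [substPow_eq]
  rw [evalSeries_prod _ fun i _ =>
    ((overconvergent_pulitaExp hF hπ φ 0).subst (by simp) (hpi i)).absConv hu]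
  simp only [evalSeries_subst _ _ (hpi _), one_mul]
  induction s with
  | zero => simpa using hpos
  | succ s ih =>
    have hsum : ‖∑ i ∈ Finset.range s, u ^ p ^ i‖ ≤ 1 :=
      IsUltrametricDist.norm_sum_le_of_forall_le_of_nonneg zero_le_one fun i _ => hui i
    have hone : ∀ x : ℂ_[p], ‖x‖ ≤ 1 → ‖1 + π 0 * x‖ ≤ 1 := fun x hx => norm_one_add_le_one (by
      rw [norm_mul]; exact mul_le_one₀ hπ1.le (norm_nonneg _) hx)
    rw [Finset.prod_range_succ, Finset.sum_range_succ]
    have h1 := norm_mul_sub_mul_lt ih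
      (norm_evalSeries_pulitaExp_zero_sub_lt hF hπ φ (hui s))
      (norm_le_one_of_norm_sub_lt (hone _ hsum) (ih.trans hπ1)) (hone _ (hui s))
    set P := (∏ i ∈ Finset.range s, evalSeries (pulitaExp φ π 0 1) (u ^ p ^ i)) *
      evalSeries (pulitaExp φ π 0 1) (u ^ p ^ s)
    set S := ∑ i ∈ Finset.range s, u ^ p ^ i
    rw [show P - (1 + π 0 * (S + u ^ p ^ s)) =
      (P - (1 + π 0 * S) * (1 + π 0 * u ^ p ^ s)) + π 0 * (π 0 * (S * u ^ p ^ s)) by ring]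
    refine (IsUltrametricDist.norm_add_le_max _ _).trans_lt (max_lt h1 ?_)
    rw [norm_mul, norm_mul, norm_mul]
    have h2 : ‖S‖ * ‖u ^ p ^ s‖ ≤ 1 := mul_le_one₀ hsum (norm_nonneg _) (hui s)
    calc ‖π 0‖ * (‖π 0‖ * (‖S‖ * ‖u ^ p ^ s‖)) ≤ ‖π 0‖ * (‖π 0‖ * 1) := by gcongr
      _ < ‖π 0‖ := by rw [mul_one]; exact mul_lt_of_lt_one_right hpos hπ1

end FirstOrder

/-! ### The ring `ℤ_p[μ_{q-1}]` and its reductions -/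

section RingMu

variable {p : ℕ} [Fact p.Prime] {s : ℕ}

theorem one_lt_prime_pow (hs : 1 ≤ s) : 1 < p ^ s :=
  Nat.one_lt_pow (by omega) (Fact.out : p.Prime).one_lt

theorem norm_le_one_of_mem_ringMu (hs : 1 ≤ s) {z : ℂ_[p]} (hz : z ∈ ringMu p s) : ‖z‖ ≤ 1 := by
  have hq := one_lt_prime_pow (p := p) hs
  induction hz using Subring.closure_induction with
  | mem z hz =>
    rcases hz with ⟨a, rfl⟩ | hz
    · exact norm_ofPadicInt_le_one a
    · have h1 := congrArg norm (show z ^ (p ^ s - 1) = 1 from hz)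
      rw [norm_pow, norm_one, pow_eq_one_iff_of_nonneg (norm_nonneg z) (by omega)] at h1
      exact h1.le
  | zero => simp
  | one => simp
  | add x y _ _ hx hy => exact (IsUltrametricDist.norm_add_le_max _ _).trans (max_le hx hy)
  | neg x _ hx => rwa [norm_neg]
  | mul x y _ _ hx hy => rw [norm_mul]; exact mul_le_one₀ hx (norm_nonneg _) hy

theorem finite_rootsMu (hs : 1 ≤ s) : (rootsMu p s).Finite := by
  have hq := one_lt_prime_pow (p := p) hs
  refine Set.Finite.subset (Polynomial.nthRootsFinset (p ^ s - 1) (1 : ℂ_[p])).finite_toSet ?_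
  intro z hz
  exact (Polynomial.mem_nthRootsFinset (by omega) (1 : ℂ_[p])).mpr hz

theorem continuous_ofPadicInt : Continuous (ofPadicInt p) := by
  have h : Isometry (ofPadicInt p) := by
    refine Isometry.of_dist_eq fun x y => ?_
    rw [dist_eq_norm, ← map_sub, norm_ofPadicInt, dist_eq_norm]
  exact h.continuous

/-- The ring `ℤ_p[μ_{q-1}]` is closed in `ℂ_p`: it is spanned over the compact ring `ℤ_p` by the
finite set `μ_{q-1}`, hence compact. -/
theorem isClosed_ringMu (hs : 1 ≤ s) : IsClosed (ringMu p s : Set ℂ_[p]) := by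
  let _ : Algebra ℤ_[p] ℂ_[p] := (ofPadicInt p).toAlgebra
  have hfin : Fintype (rootsMu p s) := (finite_rootsMu hs).fintype
  let M : Submonoid ℂ_[p] :=
    { carrier := rootsMu p s
      one_mem' := one_pow _
      mul_mem' := fun {a b} ha hb => by
        change (a * b) ^ _ = 1
        rw [mul_pow, show a ^ _ = 1 from ha, show b ^ _ = 1 from hb, one_mul] }
  have h1 : ringMu p s = (Algebra.adjoin ℤ_[p] (rootsMu p s)).toSubring :=
    (Algebra.adjoin_eq_ring_closure (rootsMu p s)).symm
  have h2 : (ringMu p s : Set ℂ_[p]) =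
      (Submodule.span ℤ_[p] (Set.range fun z : rootsMu p s => (z : ℂ_[p])) : Set ℂ_[p]) := by
    have h3 := Algebra.adjoin_eq_span ℤ_[p] (rootsMu p s)
    rw [show Submonoid.closure (rootsMu p s) = M from Submonoid.closure_eq M] at h3
    rw [h1, Subtype.range_coe]
    exact congrArg (fun N : Submodule ℤ_[p] ℂ_[p] => (N : Set ℂ_[p])) h3
  have h4 : (ringMu p s : Set ℂ_[p]) =
      Set.range fun c : rootsMu p s → ℤ_[p] => ∑ z, ofPadicInt p (c z) * (z : ℂ_[p]) := by
    rw [h2]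
    ext x
    rw [SetLike.mem_coe, Submodule.mem_span_range_iff_exists_fun]
    rfl
  rw [h4]
  refine (isCompact_range ?_).isClosed
  exact continuous_finsetSum _ fun z _ =>
    (continuous_ofPadicInt.comp (continuous_apply z)).mul continuous_const

/-- The `q`-th power map is the identity of `ℤ_p[μ_{q-1}] / p`. -/
theorem exists_pow_sub_eq_mul (hs : 1 ≤ s) (z : ringMu p s) :
    (p : ringMu p s) ∣ z ^ p ^ s - z := by
  have hq := one_lt_prime_pow (p := p) hs
  have hmul : ∀ x y : ringMu p s, (p : ringMu p s) ∣ x ^ p ^ s - x →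
      (p : ringMu p s) ∣ y ^ p ^ s - y → (p : ringMu p s) ∣ (x * y) ^ p ^ s - x * y := by
    intro x y hx hy
    rw [show (x * y) ^ p ^ s - x * y = x ^ p ^ s * (y ^ p ^ s - y) + (x ^ p ^ s - x) * y by ring]
    exact dvd_add (hy.mul_left _) (hx.mul_right _)
  have hpadic : ∀ a : ℤ_[p], ∀ h, (p : ringMu p s) ∣
      (⟨ofPadicInt p a, h⟩ : ringMu p s) ^ p ^ s - ⟨ofPadicInt p a, h⟩ := by
    intro a h
    have h1 : PadicInt.toZMod (a ^ p ^ s - a) = 0 := by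
      rw [map_sub, map_pow, ZMod.pow_card_pow, sub_self]
    rw [← RingHom.mem_ker, PadicInt.ker_toZMod, PadicInt.maximalIdeal_eq_span_p,
      Ideal.mem_span_singleton] at h1
    obtain ⟨c, hc⟩ := h1
    refine ⟨⟨ofPadicInt p c, Subring.subset_closure (Or.inl ⟨c, rfl⟩)⟩, ?_⟩
    apply Subtype.coe_injective
    have := congrArg (ofPadicInt p) hc
    simpa using this
  have h0 : p ^ s ≠ 0 := by omega
  obtain ⟨z, hz⟩ := z
  induction hz using Subring.closure_induction with
  | mem z hz =>
    rcases hz with ⟨a, rfl⟩ | hz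
    · exact hpadic a _
    · have : (⟨z, Subring.subset_closure (Or.inr hz)⟩ : ringMu p s) ^ p ^ s =
          ⟨z, Subring.subset_closure (Or.inr hz)⟩ := by
        apply Subtype.coe_injective
        change z ^ p ^ s = z
        rw [← Nat.sub_add_cancel hq.le, pow_succ, show z ^ (p ^ s - 1) = 1 from hz, one_mul]
      rw [this, sub_self]
      exact dvd_zero _
  | zero =>
    rw [show (⟨0, _⟩ : ringMu p s) = 0 from rfl, zero_pow h0, sub_self]
    exact dvd_zero _
  | one =>
    rw [show (⟨1, _⟩ : ringMu p s) = 1 from rfl, one_pow, sub_self]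
    exact dvd_zero _
  | add x y hx hy ihx ihy =>
    obtain ⟨r, hr⟩ := exists_add_pow_prime_pow_eq (Fact.out : p.Prime)
      (⟨x, hx⟩ : ringMu p s) ⟨y, hy⟩ s
    rw [show (⟨x + y, _⟩ : ringMu p s) = ⟨x, hx⟩ + ⟨y, hy⟩ from rfl, hr,
      show ∀ a b c d e : ringMu p s, a + b + c - (d + e) = (a - d) + (b - e) + c by intros; ring]
    exact dvd_add (dvd_add ihx ihy) (((dvd_mul_right _ _).mul_right _).mul_right _)
  | neg x hx ih =>
    have h1 : (⟨-x, neg_mem hx⟩ : ringMu p s) =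
        ⟨ofPadicInt p (-1), Subring.subset_closure (Or.inl ⟨-1, rfl⟩)⟩ * ⟨x, hx⟩ := by
      apply Subtype.coe_injective
      simp
    rw [h1]
    exact hmul _ _ (hpadic (-1) _) ih
  | mul x y hx hy ihx ihy => exact hmul ⟨x, hx⟩ ⟨y, hy⟩ ihx ihy

theorem inv_mem_ringMu (hs : 1 ≤ s) {z : ℂ_[p]} (hz : z ∈ ringMu p s) (h : ‖1 - z‖ < 1) :
    z⁻¹ ∈ ringMu p s := by
  have h1 := (hasSum_geometric_of_norm_lt_one h).tendsto_sum_nat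
  rw [sub_sub_cancel] at h1
  refine (isClosed_ringMu hs).mem_of_tendsto h1 (Filter.Eventually.of_forall fun n => ?_)
  exact sum_mem fun i _ => pow_mem (sub_mem (one_mem _) hz) i

variable {k : Type u} [Field k]

/-- The kernel of a reduction morphism consists of topologically nilpotent elements: an element `z`
of norm one has an invertible power, as `z ^ (q - 1)` is close to `1` and `ℤ_p[μ_{q-1}]` is
closed. -/
theorem norm_lt_one_of_red_eq_zero (hs : 1 ≤ s) (red : ringMu p s →+* k) {z : ringMu p s}
    (hz : red z = 0) : ‖(z : ℂ_[p])‖ < 1 := by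
  have hq := one_lt_prime_pow (p := p) hs
  by_contra hlt
  have hz1 : ‖(z : ℂ_[p])‖ = 1 := le_antisymm (norm_le_one_of_mem_ringMu hs z.2) (not_lt.mp hlt)
  obtain ⟨w, hw⟩ := exists_pow_sub_eq_mul hs z
  have hw' : (z : ℂ_[p]) * (1 - (z : ℂ_[p]) ^ (p ^ s - 1)) = - (p * (w : ℂ_[p])) := by
    have := congrArg (Subtype.val) hw
    simp only [AddSubgroupClass.coe_sub, Subring.coe_pow, Subring.coe_mul,
      Subring.coe_natCast] at this
    rw [← this, mul_sub, ← pow_succ', Nat.sub_add_cancel hq.le]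
    ring
  have hlt1 : ‖1 - (z : ℂ_[p]) ^ (p ^ s - 1)‖ < 1 := by
    have h1 := congrArg norm hw'
    rw [norm_mul, hz1, one_mul, norm_neg, norm_mul] at h1
    rw [h1]
    exact (mul_le_of_le_one_right (norm_nonneg _) (norm_le_one_of_mem_ringMu hs w.2)).trans_lt
      norm_natCast_lt_one
  have hinv := inv_mem_ringMu hs (pow_mem z.2 (p ^ s - 1)) hlt1
  have hmul : z ^ (p ^ s - 1) * ⟨_, hinv⟩ = 1 := by
    apply Subtype.coe_injective
    have hz0 : (z : ℂ_[p]) ≠ 0 := by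
      intro h0
      rw [h0, norm_zero] at hz1
      exact zero_ne_one hz1
    exact mul_inv_cancel₀ (pow_ne_zero _ hz0)
  have := congrArg red hmul
  rw [map_mul, map_pow, hz, zero_pow (by omega), zero_mul, map_one] at this
  exact zero_ne_one this

/-- Teichmüller lifts exist: the reduction of `X ^ (q - 1) - 1 = ∏ (X - ζ)` vanishes at every
nonzero `x`, so `x` is the reduction of a root of unity `ζ`. -/
theorem exists_teich [Fintype k] (hk : Fintype.card k = p ^ s) (hs : 1 ≤ s)
    (red : ringMu p s →+* k) (x : k) : ∃ z : ringMu p s, z ^ p ^ s = z ∧ red z = x := by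
  have hq := one_lt_prime_pow (p := p) hs
  rcases eq_or_ne x 0 with rfl | hx
  · exact ⟨0, zero_pow (by omega), map_zero red⟩
  have : NeZero (p ^ s - 1) := ⟨by omega⟩
  have : NeZero ((p ^ s - 1 : ℕ) : ℂ_[p]) := ⟨Nat.cast_ne_zero.mpr (by omega)⟩
  obtain ⟨ζ, hζ⟩ := HasEnoughRootsOfUnity.exists_primitiveRoot ℂ_[p] (p ^ s - 1)
  let ζ' : ringMu p s := ⟨ζ, Subring.subset_closure (Or.inr hζ.pow_eq_one)⟩
  have hζ' : IsPrimitiveRoot ζ' (p ^ s - 1) :=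
    IsPrimitiveRoot.of_map_of_injective (f := (ringMu p s).subtype) hζ Subtype.coe_injective
  have h1 := Polynomial.X_pow_sub_one_eq_prod (by omega) hζ'
  have h2 := congrArg (Polynomial.eval₂ red x) h1
  rw [Polynomial.eval₂_finsetProd] at h2
  simp only [Polynomial.eval₂_sub, Polynomial.eval₂_X_pow, Polynomial.eval₂_one,
    Polynomial.eval₂_X, Polynomial.eval₂_C] at h2
  rw [← hk, FiniteField.pow_card_sub_one_eq_one x hx, sub_self, eq_comm,
    Finset.prod_eq_zero_iff] at h2
  obtain ⟨z, hz, hzx⟩ := h2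
  rw [hk, Polynomial.mem_nthRootsFinset (by omega)] at hz
  refine ⟨z, ?_, (sub_eq_zero.mp hzx).symm⟩
  rw [← Nat.sub_add_cancel hq.le, pow_succ, hz, one_mul]

/-- The Teichmüller lift, as an element of `ℤ_p[μ_{q-1}]`. -/
def teichLift (red : ringMu p s →+* k) (x : k) : ringMu p s :=
  Classical.epsilon fun z : ringMu p s => z ^ p ^ s = z ∧ red z = x

theorem coe_teichLift (red : ringMu p s →+* k) (x : k) : (teichLift red x : ℂ_[p]) = teich red x :=
  rfl

theorem teichLift_spec [Fintype k] (hk : Fintype.card k = p ^ s) (hs : 1 ≤ s)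
    (red : ringMu p s →+* k) (x : k) :
    teichLift red x ^ p ^ s = teichLift red x ∧ red (teichLift red x) = x :=
  Classical.epsilon_spec (exists_teich hk hs red x)

theorem red_ne_zero_of_pow_eq (hs : 1 ≤ s) (red : ringMu p s →+* k) {z : ringMu p s}
    (hz : z ^ p ^ s = z) (h0 : z ≠ 0) : red z ≠ 0 := by
  have hq := one_lt_prime_pow (p := p) hs
  intro h
  have h1 : z ^ (p ^ s - 1) = 1 := by
    apply mul_right_cancel₀ h0
    rw [← pow_succ, Nat.sub_add_cancel hq.le, hz, one_mul]
  have := congrArg red h1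
  rw [map_pow, h, zero_pow (by omega), map_one] at this
  exact zero_ne_one this

theorem norm_eq_one_of_red_ne_zero [Fintype k] (hk : Fintype.card k = p ^ s) (hs : 1 ≤ s)
    (red : ringMu p s →+* k) {z : ringMu p s} (hz : red z ≠ 0) : ‖(z : ℂ_[p])‖ = 1 := by
  refine le_antisymm (norm_le_one_of_mem_ringMu hs z.2) (not_lt.mp fun hlt => ?_)
  obtain ⟨b, -, hb⟩ := exists_teich hk hs red (red z)⁻¹
  have h1 : red (1 - z * b) = 0 := by
    rw [map_sub, map_one, map_mul, hb, mul_inv_cancel₀ hz, sub_self]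
  have h2 := norm_lt_one_of_red_eq_zero hs red h1
  have h3 : ‖(z : ℂ_[p]) * b‖ < 1 := by
    rw [norm_mul]
    exact (mul_le_of_le_one_right (norm_nonneg _) (norm_le_one_of_mem_ringMu hs b.2)).trans_lt hlt
  have h4 : ‖(1 : ℂ_[p])‖ < 1 := by
    rw [show (1 : ℂ_[p]) = (1 - z * b : ringMu p s) + z * b by simp]
    exact (IsUltrametricDist.norm_add_le_max _ _).trans_lt (max_lt h2 h3)
  simp at h4

/-- The Witt vector over `ℤ_p[μ_{q-1}]` whose components are the Teichmüller lifts of those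
of `y`. -/
def teichWitt {ℓ : ℕ} (red : ringMu p s →+* k) (y : TruncatedWittVector p ℓ k) :
    WittVector p (ringMu p s) :=
  WittVector.mk p fun i => if h : i < ℓ then teichLift red (y.coeff ⟨i, h⟩) else 0

theorem coeff_teichWitt {ℓ : ℕ} (red : ringMu p s →+* k) (y : TruncatedWittVector p ℓ k)
    (j : Fin ℓ) : (teichWitt red y).coeff j = teichLift red (y.coeff j) := by
  simp [teichWitt]

theorem truncate_map_teichWitt [Fintype k] (hk : Fintype.card k = p ^ s) (hs : 1 ≤ s) {ℓ : ℕ}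
    (red : ringMu p s →+* k) (y : TruncatedWittVector p ℓ k) :
    WittVector.truncate ℓ (WittVector.map red (teichWitt red y)) = y := by
  ext j
  rw [WittVector.coeff_truncate, WittVector.map_coeff, coeff_teichWitt,
    (teichLift_spec hk hs red _).2]

theorem teichWitt_coeff_pow [Fintype k] (hk : Fintype.card k = p ^ s) (hs : 1 ≤ s) {ℓ : ℕ}
    (red : ringMu p s →+* k) (y : TruncatedWittVector p ℓ k) (j : ℕ) :
    (teichWitt red y).coeff j ^ p ^ s = (teichWitt red y).coeff j := by
  simp only [teichWitt, WittVector.coeff_mk]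
  split_ifs
  · exact (teichLift_spec hk hs red _).1
  · exact zero_pow (pow_ne_zero _ (Fact.out : p.Prime).ne_zero)

theorem norm_coeff_lt_one_of_truncate_map_eq_zero (hs : 1 ≤ s) {ℓ : ℕ} (red : ringMu p s →+* k)
    {c : WittVector p (ringMu p s)} (hc : WittVector.truncate ℓ (WittVector.map red c) = 0)
    {j : ℕ} (hj : j < ℓ) : ‖(c.coeff j : ℂ_[p])‖ < 1 := by
  apply norm_lt_one_of_red_eq_zero hs red
  have h := congrArg (fun x => TruncatedWittVector.coeff ⟨j, hj⟩ x) hc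
  rw [WittVector.coeff_truncate, WittVector.map_coeff] at h
  simpa using h

end RingMu

/-! ### Values along a weighted line -/

section Values

open PowerSeries

variable {p : ℕ} [Fact p.Prime] {F : ℤ_[p]⟦X⟧} {π : ℕ → ℂ_[p]}

theorem ghostShift_sum {ι : Type*} (s : Finset ι) (j : ℕ) (c : ℂ_[p]) (w : ι → ℕ → ℂ_[p]) :
    ghostShift p j c (∑ i ∈ s, w i) = ∑ i ∈ s, ghostShift p j c (w i) := by
  ext n
  simp only [ghostShift, Finset.sum_apply]
  split_ifs
  · rw [Finset.mul_sum]
  · simp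

/-- The Witt vector whose components are the `d`-th powers of those of `a`. -/
def powCoeff {R : Type*} [Monoid R] (d : ℕ) (a : WittVector p R) : WittVector p R :=
  WittVector.mk p fun i => a.coeff i ^ d

/-- The exponential `E(ϖ_m a)`. -/
def expVarpi (π : ℕ → ℂ_[p]) (m : ℕ) (a : WittVector p ℂ_[p]) : ℂ_[p]⟦X⟧ :=
  artinHasseMap (varpi π m * a)

theorem expVarpi_add (m : ℕ) (a b : WittVector p ℂ_[p]) :
    expVarpi π m (a + b) = expVarpi π m a * expVarpi π m b := by
  simp only [expVarpi, artinHasseMap_eq_ghostExp]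
  rw [← ghostExp_add]
  congr 1
  ext n
  rw [mul_add, map_add]
  rfl

theorem expVarpi_sum {ι : Type*} (s : Finset ι) (m : ℕ) (a : ι → WittVector p ℂ_[p]) :
    expVarpi π m (∑ i ∈ s, a i) = ∏ i ∈ s, expVarpi π m (a i) := by
  simp only [expVarpi, artinHasseMap_eq_ghostExp]
  rw [← ghostExp_sum]
  congr 1
  ext n
  rw [Finset.mul_sum, map_sum, Finset.sum_apply]

/-- The series `∏_j θ_{ℓ-1-j,s}(1)(a_j X ^ (p ^ j))`. -/
def lineSeries (φ : ℂ_[p] →+* ℂ_[p]) (π : ℕ → ℂ_[p]) (ℓ s : ℕ) (a : WittVector p ℂ_[p]) :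
    ℂ_[p]⟦X⟧ :=
  ∏ j ∈ Finset.range ℓ, (pulitaExpGen φ π (ℓ - 1 - j) s 1).subst
    (C (a.coeff j) * X ^ p ^ j : ℂ_[p]⟦X⟧)

/-- The product `∏_j θ_{ℓ-1-j,s}(1)(a_j)`. -/
def wittValue (φ : ℂ_[p] →+* ℂ_[p]) (π : ℕ → ℂ_[p]) (ℓ s : ℕ) (a : WittVector p ℂ_[p]) : ℂ_[p] :=
  ∏ j ∈ Finset.range ℓ, evalSeries (pulitaExpGen φ π (ℓ - 1 - j) s 1) (a.coeff j)

theorem prime_pow_ne_zero (j : ℕ) : p ^ j ≠ 0 := pow_ne_zero _ (Fact.out : p.Prime).ne_zero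

theorem overconvergent_lineSeries (hF : IsLubinTate p F) (hπ : IsTateGenerator F π)
    (φ : ℂ_[p] →+* ℂ_[p]) (ℓ s : ℕ) {a : WittVector p ℂ_[p]} (ha : ∀ j, ‖a.coeff j‖ ≤ 1) :
    Overconvergent (lineSeries φ π ℓ s a) :=
  Overconvergent.prod _ fun j _ =>
    (overconvergent_pulitaExpGen hF hπ φ _ s).subst (ha j) (prime_pow_ne_zero j)

theorem evalSeries_lineSeries (hF : IsLubinTate p F) (hπ : IsTateGenerator F π)
    (φ : ℂ_[p] →+* ℂ_[p]) (ℓ s : ℕ) {a : WittVector p ℂ_[p]} (ha : ∀ j, ‖a.coeff j‖ ≤ 1) :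
    evalSeries (lineSeries φ π ℓ s a) 1 = wittValue φ π ℓ s a := by
  rw [lineSeries, evalSeries_prod]
  · simp only [evalSeries_subst _ _ (prime_pow_ne_zero _), one_pow, mul_one]
    rfl
  · exact fun j _ => ((overconvergent_pulitaExpGen hF hπ φ _ s).subst (ha j)
      (prime_pow_ne_zero j)).absConv (by simp)

/-- The product of the `θ_{ℓ-1-j,s}(1)(a_j X ^ (p ^ j))` is the quotient of `E(ϖ_{ℓ-1} a)(X)` by the
series `E(ϖ_{ℓ-1} a')(X ^ q)`, where `a'` has the components `a_j ^ q`. -/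
theorem lineSeries_mul (φ : ℂ_[p] →+* ℂ_[p]) {ℓ : ℕ} (hℓ : 1 ≤ ℓ) (s : ℕ)
    (a : WittVector p ℂ_[p]) :
    lineSeries φ π ℓ s a * substPow (p ^ s) (expVarpi π (ℓ - 1) (powCoeff (p ^ s) a)) =
      expVarpi π (ℓ - 1) a := by
  simp only [lineSeries, expVarpi, artinHasseMap_varpi_mul, artinHasseMap_varpi, ghostExp_subst,
    pulitaExpGen_one, Nat.sub_add_cancel hℓ, powCoeff, WittVector.coeff_mk]
  rw [← ghostExp_sum, ← ghostExp_sum, ← ghostExp_sum, substPow_ghostExp, ← ghostExp_add]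
  congr 1
  rw [ghostShift_sum, ← Finset.sum_add_distrib]
  refine Finset.sum_congr rfl fun j _ => ?_
  rw [ghostShift_sub, ghostShift_ghostShift_one]
  abel

theorem hasSubst_X_pow (s : ℕ) : HasSubst (X ^ p ^ s : ℂ_[p]⟦X⟧) :=
  HasSubst.of_constantCoeff_zero' (by simp [(Fact.out : p.Prime).ne_zero])

theorem substPow_mul (s : ℕ) (f g : ℂ_[p]⟦X⟧) :
    substPow (p ^ s) (f * g) = substPow (p ^ s) f * substPow (p ^ s) g :=
  subst_mul (hasSubst_X_pow s) f g

theorem substPow_prod {ι : Type*} (t : Finset ι) (s : ℕ) (f : ι → ℂ_[p]⟦X⟧) :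
    substPow (p ^ s) (∏ i ∈ t, f i) = ∏ i ∈ t, substPow (p ^ s) (f i) := by
  simp only [substPow, ← coe_substAlgHom (hasSubst_X_pow (p := p) s)]
  exact map_prod _ _ _

theorem evalSeries_substPow (s : ℕ) (f : ℂ_[p]⟦X⟧) :
    evalSeries (substPow (p ^ s) f) 1 = evalSeries f 1 := by
  rw [substPow_eq, evalSeries_subst _ _ (prime_pow_ne_zero s)]
  simp

theorem substPow_expVarpi_ne_zero (s m : ℕ) (a : WittVector p ℂ_[p]) :
    substPow (p ^ s) (expVarpi π m a) ≠ 0 := by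
  intro h
  have h1 : constantCoeff (substPow (p ^ s) (expVarpi π m a)) = 1 := by
    rw [expVarpi, artinHasseMap_eq_ghostExp, substPow_ghostExp, constantCoeff_ghostExp]
  rw [h, map_zero] at h1
  exact zero_ne_one h1

theorem evalSeries_expVarpi_ne_zero (hF : IsLubinTate p F) (hπ : IsTateGenerator F π) {m : ℕ}
    {c : WittVector p ℂ_[p]} (hc : ∀ j ≤ m, ‖c.coeff j‖ < 1) :
    evalSeries (expVarpi π m c) 1 ≠ 0 := by
  have hc' : ∀ j ∈ Finset.range (m + 1), ‖c.coeff j‖ < 1 := fun j hj =>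
    hc j (by simpa [Nat.lt_succ_iff] using hj)
  rw [expVarpi, artinHasseMap_varpi_mul, evalSeries_prod _ fun j hj =>
    (overconvergent_subst (norm_coeff_artinHasseMap_varpi_le_one hF hπ _) (hc' j hj)
      (prime_pow_ne_zero j)).absConv (by simp), Finset.prod_ne_zero_iff]
  intro j hj
  rw [evalSeries_subst _ _ (prime_pow_ne_zero j), one_pow, mul_one]
  have h := (oneMod_artinHasseMap_varpi hF hπ (m - j)).norm_evalSeries_sub_one_le
    (absConv_of_norm_coeff_le_one (norm_coeff_artinHasseMap_varpi_le_one hF hπ _) (hc' j hj))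
    (hc' j hj).le
  intro h0
  rw [h0, zero_sub, norm_neg, norm_one] at h
  exact absurd (hπ.norm_lt_one (m - j)) (not_lt.mpr h)

/-- The functional equation behind the theorem. Let `b` be congruent to `∑ a_i` modulo Witt vectors
with topologically nilpotent components. If `b` is fixed by the componentwise `q`-th power, and if
this map preserves the sum of the `a_i`, then the value at `b` is the product of the values at
the `a_i`: the quotients `E(ϖ a)(X) / E(ϖ a)(X ^ q)` are multiplicative in `a`, and those
with `a` topologically nilpotent have the value `1` at `X = 1`. -/
theorem wittValue_eq_prod (hF : IsLubinTate p F) (hπ : IsTateGenerator F π)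
    (φ : ℂ_[p] →+* ℂ_[p]) {ℓ : ℕ} (hℓ : 1 ≤ ℓ) (s : ℕ) {ι : Type*} (t : Finset ι)
    {a : ι → WittVector p ℂ_[p]} {b : WittVector p ℂ_[p]}
    (ha : ∀ i j, ‖(a i).coeff j‖ ≤ 1) (hb : ∀ j, ‖b.coeff j‖ ≤ 1)
    (hbq : powCoeff (p ^ s) b = b) (haq : ∑ i ∈ t, powCoeff (p ^ s) (a i) = ∑ i ∈ t, a i)
    (hc : ∀ j < ℓ, ‖(b - ∑ i ∈ t, a i).coeff j‖ < 1) :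
    wittValue φ π ℓ s b = ∏ i ∈ t, wittValue φ π ℓ s (a i) := by
  set c := b - ∑ i ∈ t, a i with hcdef
  set M := ℓ - 1 with hM
  have hbc : b = ∑ i ∈ t, a i + c := by rw [hcdef]; ring
  have hc' : ∀ j ≤ M, ‖c.coeff j‖ < 1 := fun j hj => hc j (by omega)
  have h1 : lineSeries φ π ℓ s b * (substPow (p ^ s) (expVarpi π M (∑ i ∈ t, a i)) *
      substPow (p ^ s) (expVarpi π M c)) =
      expVarpi π M (∑ i ∈ t, a i) * expVarpi π M c := by
    rw [← substPow_mul, ← expVarpi_add, ← hbc]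
    have := lineSeries_mul (π := π) φ hℓ s b
    rwa [hbq] at this
  have h2 : (∏ i ∈ t, lineSeries φ π ℓ s (a i)) *
      substPow (p ^ s) (expVarpi π M (∑ i ∈ t, a i)) = expVarpi π M (∑ i ∈ t, a i) := by
    conv_lhs => rw [← haq, expVarpi_sum, substPow_prod, ← Finset.prod_mul_distrib]
    rw [expVarpi_sum]
    exact Finset.prod_congr rfl fun i _ => lineSeries_mul φ hℓ s (a i)
  have h3 : lineSeries φ π ℓ s b * substPow (p ^ s) (expVarpi π M c) =
      (∏ i ∈ t, lineSeries φ π ℓ s (a i)) * expVarpi π M c := by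
    apply mul_right_cancel₀ (substPow_expVarpi_ne_zero (π := π) s M (∑ i ∈ t, a i))
    linear_combination h1 - expVarpi π M c * h2
  have hEc : Overconvergent (expVarpi π M c) := overconvergent_artinHasseMap_varpi_mul hF hπ hc'
  have hSc : Overconvergent (substPow (p ^ s) (expVarpi π M c)) := by
    rw [substPow_eq]
    exact hEc.subst (by simp) (prime_pow_ne_zero s)
  have hline : ∀ i ∈ t, AbsConv (lineSeries φ π ℓ s (a i)) 1 := fun i _ =>
    (overconvergent_lineSeries hF hπ φ ℓ s (ha i)).absConv (by simp)
  have h4 : evalSeries _ 1 = evalSeries _ 1 := congrArg (fun f => evalSeries f 1) h3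
  rw [evalSeries_mul ((overconvergent_lineSeries hF hπ φ ℓ s hb).absConv (by simp))
    (hSc.absConv (by simp)), evalSeries_mul (absConv_prod t hline) (hEc.absConv (by simp)),
    evalSeries_substPow, evalSeries_prod t hline] at h4
  have h5 := mul_right_cancel₀ (evalSeries_expVarpi_ne_zero hF hπ hc') h4
  rw [evalSeries_lineSeries hF hπ φ ℓ s hb] at h5
  rw [h5]
  exact Finset.prod_congr rfl fun i _ => evalSeries_lineSeries hF hπ φ ℓ s (ha i)

/-- Valid over `ℂ_p` since the ghost map is injective. -/
theorem coeff_teichmuller_mul (t : ℂ_[p]) (a : WittVector p ℂ_[p]) (j : ℕ) :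
    (WittVector.teichmuller p t * a).coeff j = t ^ p ^ j * a.coeff j := by
  have h : WittVector.teichmuller p t * a = WittVector.mk p fun j => t ^ p ^ j * a.coeff j := by
    refine wittVector_ext_ghost fun n => ?_
    rw [map_mul, WittVector.ghostComponent_teichmuller, WittVector.ghostComponent_apply,
      WittVector.ghostComponent_apply, aeval_wittPolynomial, aeval_wittPolynomial, Finset.mul_sum]
    refine Finset.sum_congr rfl fun i hi => ?_
    have hi' : i ≤ n := by simpa [Nat.lt_succ_iff] using hi
    simp only [WittVector.coeff_mk]
    rw [mul_pow, ← pow_mul, ← pow_add, Nat.add_sub_cancel' hi']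
    ring
  rw [h, WittVector.coeff_mk]

end Values

/-! ### Products of series in separate variables -/

section MultiVariable

variable {p : ℕ} [Fact p.Prime] {ℓ : ℕ}

theorem termAt_mul (f g : MvPowerSeries (Fin ℓ) ℂ_[p]) (x : Fin ℓ → ℂ_[p]) (n : Fin ℓ →₀ ℕ) :
    termAt (f * g) x n = ∑ kl ∈ Finset.HasAntidiagonal.antidiagonal n,
      termAt f x kl.1 * termAt g x kl.2 := by
  classical
  rw [termAt, MvPowerSeries.coeff_mul, Finset.sum_mul]
  refine Finset.sum_congr rfl fun kl hkl => ?_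
  rw [← Finset.HasAntidiagonal.mem_antidiagonal.mp hkl, termAt, termAt]
  simp only [Finsupp.add_apply, pow_add, Finset.prod_mul_distrib]
  ring

theorem summable_norm_termAt_mul {f g : MvPowerSeries (Fin ℓ) ℂ_[p]} {x : Fin ℓ → ℂ_[p]}
    (hf : Summable fun n => ‖termAt f x n‖) (hg : Summable fun n => ‖termAt g x n‖) :
    Summable fun n => ‖termAt (f * g) x n‖ := by
  have h := summable_sum_mul_antidiagonal_of_summable_mul
    (Summable.mul_of_nonneg hf hg (fun _ => norm_nonneg _) fun _ => norm_nonneg _)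
  refine h.of_nonneg_of_le (fun _ => norm_nonneg _) fun n => ?_
  rw [termAt_mul]
  exact (norm_sum_le _ _).trans (Finset.sum_le_sum fun kl _ => (norm_mul _ _).le)

theorem evalAt_mul {f g : MvPowerSeries (Fin ℓ) ℂ_[p]} {x : Fin ℓ → ℂ_[p]}
    (hf : Summable fun n => ‖termAt f x n‖) (hg : Summable fun n => ‖termAt g x n‖) :
    evalAt (f * g) x = evalAt f x * evalAt g x := by
  simp only [evalAt, termAt_mul]
  exact (hf.of_norm.tsum_mul_tsum_eq_tsum_sum_antidiagonal hg.of_norm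
    (summable_mul_of_summable_norm hf hg)).symm

theorem termAt_one (x : Fin ℓ → ℂ_[p]) (n : Fin ℓ →₀ ℕ) :
    termAt 1 x n = if n = 0 then 1 else 0 := by
  classical
  rw [termAt, MvPowerSeries.coeff_one]
  split_ifs with h
  · simp [h]
  · simp

theorem evalAt_prod {ι : Type*} (s : Finset ι) {f : ι → MvPowerSeries (Fin ℓ) ℂ_[p]}
    {x : Fin ℓ → ℂ_[p]} (hf : ∀ i ∈ s, Summable fun n => ‖termAt (f i) x n‖) :
    (Summable fun n => ‖termAt (∏ i ∈ s, f i) x n‖) ∧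
      evalAt (∏ i ∈ s, f i) x = ∏ i ∈ s, evalAt (f i) x := by
  classical
  induction s using Finset.induction_on with
  | empty =>
    simp only [Finset.prod_empty, evalAt, termAt_one]
    constructor
    · refine summable_of_ne_finset_zero (s := {0}) fun n hn => ?_
      simp only [Finset.mem_singleton] at hn
      simp [hn]
    · rw [tsum_ite_eq]
  | insert a s ha ih =>
    have h1 := hf a (Finset.mem_insert_self a s)
    have h2 := ih fun i hi => hf i (Finset.mem_insert_of_mem hi)
    rw [Finset.prod_insert ha, Finset.prod_insert ha]
    exact ⟨summable_norm_termAt_mul h1 h2.1, by rw [evalAt_mul h1 h2.1, h2.2]⟩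

theorem coeff_subst_C_mul_X (f : ℂ_[p]⟦X⟧) (c : ℂ_[p]) (j : Fin ℓ) (n : Fin ℓ →₀ ℕ) :
    MvPowerSeries.coeff n (f.subst
      (MvPowerSeries.C c * MvPowerSeries.X j : MvPowerSeries (Fin ℓ) ℂ_[p])) =
      if n = Finsupp.single j (n j) then PowerSeries.coeff (n j) f * c ^ n j else 0 := by
  classical
  have hs : PowerSeries.HasSubst
      (MvPowerSeries.C c * MvPowerSeries.X j : MvPowerSeries (Fin ℓ) ℂ_[p]) :=
    PowerSeries.HasSubst.of_constantCoeff_zero (by simp)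
  rw [PowerSeries.coeff_subst hs]
  have hk : ∀ k, MvPowerSeries.coeff n
      ((MvPowerSeries.C c * MvPowerSeries.X j : MvPowerSeries (Fin ℓ) ℂ_[p]) ^ k) =
      if n = Finsupp.single j k then c ^ k else 0 := by
    intro k
    rw [mul_pow, ← map_pow, MvPowerSeries.coeff_C_mul, MvPowerSeries.coeff_X_pow]
    simp
  simp only [hk]
  rw [finsum_eq_single _ (n j)]
  · simp
  · intro k hkn
    rw [if_neg, smul_zero]
    intro h
    apply hkn
    rw [h]
    simp

theorem termAt_subst (f : ℂ_[p]⟦X⟧) (c : ℂ_[p]) (j : Fin ℓ) (x : Fin ℓ → ℂ_[p]) (k : ℕ) :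
    termAt (f.subst (MvPowerSeries.C c * MvPowerSeries.X j : MvPowerSeries (Fin ℓ) ℂ_[p])) x
      (Finsupp.single j k) = PowerSeries.coeff k f * (c * x j) ^ k := by
  classical
  rw [termAt, coeff_subst_C_mul_X, Finset.prod_eq_single j]
  · simp [mul_pow]
    ring
  · intro i _ hi
    simp [hi.symm]
  · simp

theorem termAt_subst_of_notMem (f : ℂ_[p]⟦X⟧) (c : ℂ_[p]) (j : Fin ℓ) (x : Fin ℓ → ℂ_[p])
    {n : Fin ℓ →₀ ℕ} (hn : n ∉ Set.range fun k : ℕ => Finsupp.single j k) :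
    termAt (f.subst (MvPowerSeries.C c * MvPowerSeries.X j : MvPowerSeries (Fin ℓ) ℂ_[p])) x n =
      0 := by
  rw [termAt, coeff_subst_C_mul_X, if_neg, zero_mul]
  exact fun h => hn ⟨n j, h.symm⟩

theorem summable_norm_termAt_subst {f : ℂ_[p]⟦X⟧} {c : ℂ_[p]} {j : Fin ℓ} {x : Fin ℓ → ℂ_[p]}
    (hf : AbsConv f (c * x j)) : Summable fun n => ‖termAt (f.subst
      (MvPowerSeries.C c * MvPowerSeries.X j : MvPowerSeries (Fin ℓ) ℂ_[p])) x n‖ := by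
  have hinj : Function.Injective fun k : ℕ => Finsupp.single j k := Finsupp.single_injective j
  rw [← hinj.summable_iff]
  · simp only [Function.comp_def, termAt_subst]
    exact hf
  · intro n hn
    rw [termAt_subst_of_notMem f c j x hn, norm_zero]

theorem evalAt_subst (f : ℂ_[p]⟦X⟧) (c : ℂ_[p]) (j : Fin ℓ) (x : Fin ℓ → ℂ_[p]) :
    evalAt (f.subst (MvPowerSeries.C c * MvPowerSeries.X j : MvPowerSeries (Fin ℓ) ℂ_[p])) x =
      evalSeries f (c * x j) := by
  have hinj : Function.Injective fun k : ℕ => Finsupp.single j k := Finsupp.single_injective j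
  rw [evalAt, ← hinj.tsum_eq, evalSeries]
  · simp only [termAt_subst]
  · intro n hn
    by_contra h
    exact hn (termAt_subst_of_notMem f c j x h)

theorem coeff_prod_subst_mem {R : Subring ℂ_[p]} {f : Fin ℓ → ℂ_[p]⟦X⟧} {c : Fin ℓ → ℂ_[p]}
    (hf : ∀ j, f j ∈ seriesOver R) (hc : ∀ j, c j ∈ R) (n : Fin ℓ →₀ ℕ) :
    MvPowerSeries.coeff n (∏ j, (f j).subst
      (MvPowerSeries.C (c j) * MvPowerSeries.X j : MvPowerSeries (Fin ℓ) ℂ_[p])) ∈ R := by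
  have h : (∏ j, (f j).subst
      (MvPowerSeries.C (c j) * MvPowerSeries.X j : MvPowerSeries (Fin ℓ) ℂ_[p])) ∈
      (MvPowerSeries.map (σ := Fin ℓ) R.subtype).range := by
    refine prod_mem fun j _ => ?_
    have hj : ∀ n, MvPowerSeries.coeff n ((f j).subst
        (MvPowerSeries.C (c j) * MvPowerSeries.X j : MvPowerSeries (Fin ℓ) ℂ_[p])) ∈ R := by
      intro n
      rw [coeff_subst_C_mul_X]
      split_ifs
      · exact mul_mem (mem_seriesOver.mp (hf j) _) (pow_mem (hc j) _)
      · exact zero_mem R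
    refine ⟨fun n => ⟨_, hj n⟩, ?_⟩
    ext n
    rfl
  obtain ⟨g, hg⟩ := h
  rw [← hg, MvPowerSeries.coeff_map]
  exact (MvPowerSeries.coeff n g).2

end MultiVariable

/-! ### Values of the splitting function at Teichmüller points -/

section OmegaValues

variable {p : ℕ} [Fact p.Prime] {F : ℤ_[p]⟦X⟧} {π : ℕ → ℂ_[p]}

theorem evalSeries_apply_zero (f : ℂ_[p]⟦X⟧) :
    evalSeries f 0 = PowerSeries.constantCoeff f := by
  rw [evalSeries, tsum_eq_single 0]
  · simp
  · intro n hn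
    rw [zero_pow hn, mul_zero]

theorem evalAt_Omega (hF : IsLubinTate p F) (hπ : IsTateGenerator F π) (φ : ℂ_[p] →+* ℂ_[p])
    (ℓ s : ℕ) {t : ℂ_[p]} (ht : ‖t‖ ≤ 1) {x : Fin ℓ → ℂ_[p]} (hx : ∀ j, ‖x j‖ ≤ 1) :
    evalAt (Omega φ π ℓ s t) x =
      ∏ j : Fin ℓ, evalSeries (pulitaExpGen φ π (ℓ - 1 - j) s 1) (t ^ p ^ (j : ℕ) * x j) := by
  rw [Omega, (evalAt_prod _ _).2]
  · exact Finset.prod_congr rfl fun j _ => evalAt_subst _ _ j x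
  · intro j _
    refine summable_norm_termAt_subst ((overconvergent_pulitaExpGen hF hπ φ _ s).absConv ?_)
    rw [norm_mul, norm_pow]
    exact mul_le_one₀ (pow_le_one₀ (norm_nonneg _) ht) (norm_nonneg _) (hx j)

theorem summable_termAt_Omega (hF : IsLubinTate p F) (hπ : IsTateGenerator F π)
    (φ : ℂ_[p] →+* ℂ_[p]) (ℓ s : ℕ) {t : ℂ_[p]} (ht : ‖t‖ ≤ 1) :
    ∃ ρ : Fin ℓ → ℝ, (∀ i, 1 < ρ i) ∧ ∀ x : Fin ℓ → ℂ_[p], (∀ i, ‖x i‖ < ρ i) →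
      Summable (termAt (Omega φ π ℓ s t) x) := by
  choose ρ hρ M hM using fun j : Fin ℓ => overconvergent_pulitaExpGen hF hπ φ (ℓ - 1 - j) s
  refine ⟨ρ, hρ, fun x hx => (evalAt_prod _ fun j _ => summable_norm_termAt_subst
    (absConv_of_norm_coeff_mul_pow_le (hM j) ?_)).1.of_norm⟩
  rw [norm_mul, norm_pow]
  exact (mul_le_of_le_one_left (norm_nonneg _) (pow_le_one₀ (norm_nonneg _) ht)).trans_lt (hx j)

theorem coeff_Omega_mem (hF : IsLubinTate p F) (hπ : IsTateGenerator F π) (φ : ℂ_[p] →+* ℂ_[p])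
    (ℓ s : ℕ) {t : ℂ_[p]} {R : Subring ℂ_[p]} (hR : ringO F ≤ R) (ht : t ∈ R)
    (n : Fin ℓ →₀ ℕ) : MvPowerSeries.coeff n (Omega φ π ℓ s t) ∈ R :=
  coeff_prod_subst_mem (fun j => mem_seriesOver.mpr fun _ =>
    hR (mem_seriesOver.mp (pulitaExpGen_mem_seriesOver hF hπ φ (ℓ - 1 - j) s) _))
    (fun _ => pow_mem ht _) n

theorem evalAt_Omega_coeff (hF : IsLubinTate p F) (hπ : IsTateGenerator F π)
    (φ : ℂ_[p] →+* ℂ_[p]) (ℓ s : ℕ) {t : ℂ_[p]} (ht : ‖t‖ ≤ 1) {a : WittVector p ℂ_[p]}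
    (ha : ∀ j, ‖a.coeff j‖ ≤ 1) :
    evalAt (Omega φ π ℓ s t) (fun j => a.coeff j) =
      wittValue φ π ℓ s (WittVector.teichmuller p t * a) := by
  rw [evalAt_Omega hF hπ φ ℓ s ht fun j => ha j, wittValue, Finset.prod_range]
  simp only [coeff_teichmuller_mul]

theorem powCoeff_teichmuller_mul {d : ℕ} {t : ℂ_[p]} (ht : t ^ d = t) (a : WittVector p ℂ_[p]) :
    powCoeff d (WittVector.teichmuller p t * a) = WittVector.teichmuller p t * powCoeff d a := by
  ext j
  rw [powCoeff, WittVector.coeff_mk, coeff_teichmuller_mul, coeff_teichmuller_mul, powCoeff,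
    WittVector.coeff_mk, mul_pow, ← pow_mul, mul_comm _ d, pow_mul, ht]

theorem map_powCoeff {R S : Type*} [CommRing R] [CommRing S] (f : R →+* S) (d : ℕ)
    (a : WittVector p R) : WittVector.map f (powCoeff d a) = powCoeff d (WittVector.map f a) := by
  ext j
  simp [powCoeff, WittVector.map_coeff]

/-- The functional equation at points of the ring `ℤ_p[μ]`, where congruences are read off from a
reduction morphism. The exponents `s` and `S` differ when the trace of an extension of the field
with `p ^ s` elements is considered. -/
theorem evalAt_Omega_eq_prod (hF : IsLubinTate p F) (hπ : IsTateGenerator F π)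
    (φ : ℂ_[p] →+* ℂ_[p]) {ℓ : ℕ} (hℓ : 1 ≤ ℓ) (s : ℕ) {S : ℕ} (hS : 1 ≤ S) {t : ℂ_[p]}
    (ht : ‖t‖ ≤ 1) (htq : t ^ p ^ s = t) {k : Type*} [Field k] (red : ringMu p S →+* k)
    {ι : Type*} (T : Finset ι) {a : ι → WittVector p (ringMu p S)}
    {b : WittVector p (ringMu p S)} (hb : powCoeff (p ^ s) b = b)
    (ha : ∑ i ∈ T, powCoeff (p ^ s) (a i) = ∑ i ∈ T, a i)
    (hc : WittVector.truncate ℓ (WittVector.map red (b - ∑ i ∈ T, a i)) = 0) :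
    evalAt (Omega φ π ℓ s t) (fun j => (b.coeff j : ℂ_[p])) =
      ∏ i ∈ T, evalAt (Omega φ π ℓ s t) fun j => ((a i).coeff j : ℂ_[p]) := by
  set f := WittVector.map (p := p) (ringMu p S).subtype with hf
  have hle : ∀ (c : WittVector p (ringMu p S)) j, ‖(f c).coeff j‖ ≤ 1 := fun c j => by
    rw [hf, WittVector.map_coeff]
    exact norm_le_one_of_mem_ringMu hS (c.coeff j).2
  have hle' : ∀ (c : WittVector p (ringMu p S)) j,
      ‖(WittVector.teichmuller p t * f c).coeff j‖ ≤ 1 := fun c j => by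
    rw [coeff_teichmuller_mul, norm_mul, norm_pow]
    exact mul_le_one₀ (pow_le_one₀ (norm_nonneg _) ht) (norm_nonneg _) (hle c j)
  have hval : ∀ c : WittVector p (ringMu p S),
      evalAt (Omega φ π ℓ s t) (fun j => (c.coeff j : ℂ_[p])) =
        wittValue φ π ℓ s (WittVector.teichmuller p t * f c) := fun c => by
    rw [← evalAt_Omega_coeff hF hπ φ ℓ s ht (hle c)]
    rfl
  rw [hval, Finset.prod_congr rfl fun i _ => hval (a i)]
  refine wittValue_eq_prod hF hπ φ hℓ s T (fun i => hle' _) (hle' _) ?_ ?_ fun j hj => ?_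
  · rw [powCoeff_teichmuller_mul htq, hf, ← map_powCoeff, hb]
  · simp only [powCoeff_teichmuller_mul htq]
    rw [← Finset.mul_sum, ← Finset.mul_sum, hf, ← map_sum, ← ha, map_sum]
    simp only [map_powCoeff]
  · rw [← Finset.mul_sum, ← map_sum, ← mul_sub, ← map_sub, coeff_teichmuller_mul, norm_mul,
      norm_pow]
    exact (mul_le_of_le_one_left (norm_nonneg _) (pow_le_one₀ (norm_nonneg _) ht)).trans_lt
      (norm_coeff_lt_one_of_truncate_map_eq_zero hS red hc hj)

theorem powCoeff_teichWitt {s ℓ : ℕ} {k : Type*} [Field k] [Fintype k]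
    (hk : Fintype.card k = p ^ s) (hs : 1 ≤ s) (red : ringMu p s →+* k)
    (y : TruncatedWittVector p ℓ k) : powCoeff (p ^ s) (teichWitt red y) = teichWitt red y := by
  ext j
  rw [powCoeff, WittVector.coeff_mk, teichWitt_coeff_pow hk hs]

end OmegaValues

/-! ### The additive character -/

section Character

variable {p : ℕ} [Fact p.Prime] {F : ℤ_[p]⟦X⟧} {π : ℕ → ℂ_[p]} {ℓ s : ℕ} {k : Type u} [Field k]

theorem teich_zero [Fintype k] (hk : Fintype.card k = p ^ s) (hs : 1 ≤ s)
    (red : ringMu p s →+* k) : teich red 0 = 0 := by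
  obtain ⟨h1, h2⟩ := teichLift_spec hk hs red 0
  rw [← coe_teichLift, ZeroMemClass.coe_eq_zero]
  by_contra h
  exact red_ne_zero_of_pow_eq hs red h1 h h2

theorem exists_addChar_eq_evalAt_Omega [Fintype k] (hk : Fintype.card k = p ^ s) (hs : 1 ≤ s)
    (red : ringMu p s →+* k) (hF : IsLubinTate p F) (hπ : IsTateGenerator F π)
    (φ : ℂ_[p] →+* ℂ_[p]) (hℓ : 1 ≤ ℓ) {t : ℂ_[p]} (ht : ‖t‖ ≤ 1) (htq : t ^ p ^ s = t) :
    ∃ ψ : AddChar (TruncatedWittVector p ℓ k) ℂ_[p],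
      ∀ y, ψ y = evalAt (Omega φ π ℓ s t) fun j => teich red (y.coeff j) := by
  have hval : ∀ y : TruncatedWittVector p ℓ k, (fun j : Fin ℓ => teich red (y.coeff j)) =
      fun j : Fin ℓ => ((teichWitt red y).coeff j : ℂ_[p]) := fun y => by
    funext j
    rw [coeff_teichWitt, coe_teichLift]
  refine ⟨⟨fun y => evalAt (Omega φ π ℓ s t) fun j => teich red (y.coeff j), ?_, ?_⟩,
    fun y => rfl⟩
  · have h := evalAt_Omega_eq_prod hF hπ φ hℓ s hs ht htq red (∅ : Finset ℕ)
      (a := fun _ => 0) (powCoeff_teichWitt hk hs red (0 : TruncatedWittVector p ℓ k)) rfl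
      (by rw [Finset.sum_empty, sub_zero, truncate_map_teichWitt hk hs])
    rwa [Finset.prod_empty, ← hval] at h
  · intro y z
    have h := evalAt_Omega_eq_prod hF hπ φ hℓ s hs ht htq red (Finset.univ : Finset (Fin 2))
      (a := ![teichWitt red y, teichWitt red z]) (powCoeff_teichWitt hk hs red (y + z))
      (by simp [Fin.sum_univ_two, powCoeff_teichWitt hk hs])
      (by simp [Fin.sum_univ_two, truncate_map_teichWitt hk hs])
    rw [Fin.prod_univ_two] at h
    simp only [Matrix.cons_val_zero, Matrix.cons_val_one] at h
    simpa only [hval] using h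

theorem pow_nsmul_eq_zero [CharP k p] (y : TruncatedWittVector p ℓ k) : p ^ ℓ • y = 0 := by
  obtain ⟨x, rfl⟩ := WittVector.truncate_surjective p ℓ k y
  ext j
  rw [← map_nsmul, nsmul_eq_mul, Nat.cast_pow, mul_comm, WittVector.coeff_truncate,
    WittVector.mul_pow_charP_coeff_zero x j.2]
  simp

open Polynomial in
/-- The polynomial `∑_{i < s} X ^ (p ^ i)` has degree `p ^ (s - 1)`, less than the number of
elements of `k`. -/
theorem exists_sum_pow_prime_pow_ne_zero [Fintype k] (hk : Fintype.card k = p ^ s)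
    (hs : 1 ≤ s) : ∃ x : k, ∑ i ∈ Finset.range s, x ^ p ^ i ≠ 0 := by
  have hp : 1 < p := (Fact.out : p.Prime).one_lt
  by_contra! h
  have h0 : (∑ i ∈ Finset.range s, (X : k[X]) ^ p ^ i) = 0 := by
    refine Polynomial.eq_zero_of_natDegree_lt_card_of_eval_eq_zero _ Function.injective_id
      (fun x => by simpa [eval_finsetSum] using h x) ?_
    rw [hk]
    refine (Polynomial.natDegree_sum_le_of_forall_le (n := p ^ (s - 1)) _ _
      fun i hi => ?_).trans_lt (Nat.pow_lt_pow_right hp (by omega))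
    rw [natDegree_X_pow]
    exact Nat.pow_le_pow_right hp.le (by have := Finset.mem_range.mp hi; omega)
  have h1 := congrArg (fun P => Polynomial.coeff P 1) h0
  simp only [finsetSum_coeff, coeff_X_pow, coeff_zero] at h1
  rw [Finset.sum_eq_single 0] at h1
  · simp at h1
  · intro i _ hi
    rw [if_neg]
    exact (Nat.one_lt_pow hi hp).ne
  · intro h'
    exact absurd (Finset.mem_range.mpr (by omega)) h'

/-- The value at `p ^ (ℓ - 1) · [x]` is that of the level one function at a Teichmüller point `u`,
which is close to `1 + π_0 · ∑_i u ^ (p ^ i)`; for a suitable `x` the sum is a unit, and the value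
is not `1`. -/
theorem orderOf_eq_prime_pow_of_eq_evalAt_Omega [Fintype k] (hk : Fintype.card k = p ^ s)
    (hs : 1 ≤ s) (red : ringMu p s →+* k) (hF : IsLubinTate p F) (hπ : IsTateGenerator F π)
    (φ : ℂ_[p] →+* ℂ_[p]) (hℓ : 1 ≤ ℓ) {t : ringMu p s} (htq : t ^ p ^ s = t) (ht0 : t ≠ 0)
    {ψ : AddChar (TruncatedWittVector p ℓ k) ℂ_[p]}
    (hψ : ∀ y, ψ y = evalAt (Omega φ π ℓ s t) fun j => teich red (y.coeff j)) :
    orderOf ψ = p ^ ℓ := by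
  have hchar : CharP k p := charP_of_card_eq_prime_pow hk
  obtain ⟨n, rfl⟩ : ∃ n, ℓ = n + 1 := ⟨ℓ - 1, by omega⟩
  refine orderOf_eq_prime_pow (fun h => ?_) ?_
  · obtain ⟨x, hx⟩ := exists_sum_pow_prime_pow_ne_zero hk hs
    have hrt : red t ≠ 0 := red_ne_zero_of_pow_eq hs red htq ht0
    obtain ⟨w, hw⟩ := (bijective_iterateFrobenius k p n).2 (x / red t ^ p ^ n)
    rw [iterateFrobenius_def] at hw
    set u : ringMu p s := t ^ p ^ n * teichLift red (w ^ p ^ n) with hu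
    have hru : red u = x := by
      rw [hu, map_mul, map_pow, (teichLift_spec hk hs red _).2, hw]
      exact mul_div_cancel₀ _ (pow_ne_zero _ hrt)
    have hnorm : ‖∑ i ∈ Finset.range s, (u : ℂ_[p]) ^ p ^ i‖ = 1 := by
      have h1 := norm_eq_one_of_red_ne_zero hk hs red
        (z := ∑ i ∈ Finset.range s, u ^ p ^ i) (by simpa [hru] using hx)
      simpa using h1
    set y : TruncatedWittVector p (n + 1) k :=
      WittVector.truncate (n + 1) (WittVector.teichmuller p w * (p : WittVector p k) ^ n) with hy
    have hy1 : p ^ n • WittVector.truncate (n + 1) (WittVector.teichmuller p w) = y := by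
      rw [hy, ← map_nsmul, nsmul_eq_mul, Nat.cast_pow, mul_comm]
    -- All components of `y` but the last vanish, and their factors take the value `1` at `0`.
    have hval : ψ y = evalSeries (pulitaExpGen φ π 0 s 1) u := by
      simp only [hψ, ← coe_teichLift]
      rw [evalAt_Omega hF hπ φ _ s (norm_le_one_of_mem_ringMu hs t.2)
        fun j => norm_le_one_of_mem_ringMu hs (teichLift red (y.coeff j)).2, Fin.prod_univ_castSucc,
        Finset.prod_eq_one, one_mul]
      · rw [hy, WittVector.coeff_truncate, Fin.val_last,
          WittVector.teichmuller_mul_pow_coeff, Nat.add_sub_cancel, Nat.sub_self,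
          hu]
        simp
      · intro j _
        rw [hy, WittVector.coeff_truncate, WittVector.teichmuller_mul_pow_coeff_of_ne,
          coe_teichLift, teich_zero hk hs, mul_zero, evalSeries_apply_zero, pulitaExpGen_one,
          constantCoeff_ghostExp]
        exact j.2.ne
    have hone : ψ y = 1 := by
      rw [← hy1, AddChar.map_nsmul_eq_pow, ← AddChar.pow_apply, h, AddChar.one_apply]
    have hlt := norm_evalSeries_pulitaExpGen_zero_sub_lt hF hπ φ s
      (norm_le_one_of_mem_ringMu hs u.2)
    rw [← hval, hone, sub_add_cancel_left, norm_neg, norm_mul, hnorm, mul_one] at hlt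
    exact lt_irrefl _ hlt
  · ext y
    rw [AddChar.pow_apply, AddChar.one_apply, ← AddChar.map_nsmul_eq_pow, pow_nsmul_eq_zero,
      AddChar.map_zero_eq_one]

end Character

/-! ### The trace formula -/

section Trace

variable {p : ℕ} [Fact p.Prime] {F : ℤ_[p]⟦X⟧} {π : ℕ → ℂ_[p]} {ℓ s : ℕ} {k : Type u} [Field k]

theorem truncMap_truncate {R S : Type u} [CommRing R] [CommRing S] (f : R →+* S)
    (x : WittVector p R) :
    truncMap p ℓ f (WittVector.truncate ℓ x) = WittVector.truncate ℓ (WittVector.map f x) := by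
  ext j
  simp [WittVector.map_coeff]

/-- The Teichmüller representative of a trace is congruent to the sum of the conjugates of the
Teichmüller representative, and the conjugates are permuted by the componentwise `q`-th power. -/
theorem evalAt_Omega_wittTrace [Fintype k] (hk : Fintype.card k = p ^ s) (hs : 1 ≤ s)
    (red : ringMu p s →+* k) (hF : IsLubinTate p F) (hπ : IsTateGenerator F π)
    (φ : ℂ_[p] →+* ℂ_[p]) (hℓ : 1 ≤ ℓ) {t : ℂ_[p]} (ht : ‖t‖ ≤ 1) (htq : t ^ p ^ s = t)
    {k' : Type u} [Field k'] [Finite k'] [Algebra k k'] {r : ℕ} (hr : 1 ≤ r)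
    (hkk' : Module.finrank k k' = r) (red' : ringMu p (s * r) →+* k')
    (hred : ∀ z : ringMu p s, red' (Subring.inclusion (ringMu_le p s r) z) =
      algebraMap k k' (red z)) (y : TruncatedWittVector p ℓ k') :
    evalAt (Omega φ π ℓ s t) (fun j => teich red ((wittTrace p k k' ℓ y).coeff j)) =
      ∏ i ∈ Finset.range r,
        evalAt (Omega φ π ℓ s t) fun j => teich red' (y.coeff j) ^ (p ^ s) ^ i := by
  have hfin : Fintype k' := Fintype.ofFinite k'
  have hS : 1 ≤ s * r := Nat.mul_pos hs hr
  have hk' : Fintype.card k' = p ^ (s * r) := by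
    rw [Module.card_eq_pow_finrank (K := k), hk, hkk', pow_mul]
  set x := wittTrace p k k' ℓ y with hx
  set ι := Subring.inclusion (ringMu_le p s r) with hι
  have hxy : truncMap p ℓ (algebraMap k k') x = conjSum p k k' ℓ y :=
    (existsUnique_trace p k k' ℓ y).choose_spec.1
  have hcomp : ∀ d e (a : WittVector p (ringMu p (s * r))),
      powCoeff d (powCoeff e a) = powCoeff (e * d) a := fun d e a => by
    ext j
    simp [powCoeff, pow_mul]
  have h := evalAt_Omega_eq_prod hF hπ φ hℓ s hS ht htq red' (Finset.range r)
    (a := fun i => powCoeff ((p ^ s) ^ i) (teichWitt red' y))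
    (b := WittVector.map ι (teichWitt red x)) ?_ ?_ ?_
  · have h1 : (fun j : Fin ℓ => teich red (x.coeff j)) =
        fun j : Fin ℓ => ((WittVector.map ι (teichWitt red x)).coeff j : ℂ_[p]) := by
      funext j
      rw [WittVector.map_coeff, coeff_teichWitt, hι, Subring.coe_inclusion, coe_teichLift]
    have h2 : ∀ i, (fun j : Fin ℓ => teich red' (y.coeff j) ^ (p ^ s) ^ i) =
        fun j : Fin ℓ => ((powCoeff ((p ^ s) ^ i) (teichWitt red' y)).coeff j : ℂ_[p]) := by
      intro i
      funext j
      rw [powCoeff, WittVector.coeff_mk, coeff_teichWitt, Subring.coe_pow, coe_teichLift]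
    simpa only [h1, h2] using h
  · rw [← map_powCoeff, powCoeff_teichWitt hk hs]
  · -- The componentwise `q ^ r`-th power fixes the Teichmüller components.
    simp only [hcomp, ← pow_succ]
    have h1 := Finset.sum_range_succ
      (fun i => powCoeff ((p ^ s) ^ i) (teichWitt red' y)) r
    rw [Finset.sum_range_succ', ← pow_mul p s r, powCoeff_teichWitt hk' hS, pow_zero] at h1
    have h2 : powCoeff 1 (teichWitt red' y) = teichWitt red' y := by
      ext j
      simp [powCoeff]
    rw [h2] at h1
    exact add_right_cancel h1
  · have h1 : WittVector.map red' (WittVector.map ι (teichWitt red x)) =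
        WittVector.map (algebraMap k k') (WittVector.map red (teichWitt red x)) := by
      ext j
      simp only [WittVector.map_coeff]
      exact hred _
    rw [map_sub, map_sub, h1, ← truncMap_truncate, truncate_map_teichWitt hk hs, hxy, conjSum,
      hkk', map_sum, map_sum, sub_eq_zero]
    refine Finset.sum_congr rfl fun i _ => ?_
    ext j
    rw [coeff_truncMap, WittVector.coeff_truncate, WittVector.map_coeff, powCoeff,
      WittVector.coeff_mk, coeff_teichWitt, map_pow, (teichLift_spec hk' hS red' _).2, ← hk]
    rw [RingHom.coe_coe, AlgHom.coe_pow, FiniteField.coe_frobeniusAlgHom, pow_iterate]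

theorem isSplittingFunction_Omega [Fintype k] (hk : Fintype.card k = p ^ s) (hs : 1 ≤ s)
    (red : ringMu p s →+* k) (hF : IsLubinTate p F) (hπ : IsTateGenerator F π)
    (φ : ℂ_[p] →+* ℂ_[p]) (hℓ : 1 ≤ ℓ) {t : ringMu p s} (htq : t ^ p ^ s = t) (ht0 : t ≠ 0)
    {R : Subring ℂ_[p]} (hR : ringO F ≤ R) (htR : (t : ℂ_[p]) ∈ R) :
    IsSplittingFunction red ℓ R (Omega φ π ℓ s t) := by
  have ht : ‖(t : ℂ_[p])‖ ≤ 1 := norm_le_one_of_mem_ringMu hs t.2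
  have htq' : (t : ℂ_[p]) ^ p ^ s = t := congrArg Subtype.val htq
  obtain ⟨ψ, hψ⟩ := exists_addChar_eq_evalAt_Omega hk hs red hF hπ φ hℓ ht htq'
  refine ⟨coeff_Omega_mem hF hπ φ ℓ s hR htR, summable_termAt_Omega hF hπ φ ℓ s ht, ψ, hψ,
    orderOf_eq_prime_pow_of_eq_evalAt_Omega hk hs red hF hπ φ hℓ htq ht0 hψ, ?_⟩
  intro r hr k' _ _ _ hkk' red' hred y
  rw [hψ]
  exact evalAt_Omega_wittTrace hk hs red hF hπ φ hℓ ht htq' hr hkk' red' hred y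

end Trace

end SplittingFunctions

end

open SplittingFunctions in
theorem mainTheorem1 (p : ℕ) [Fact p.Prime]
    (F : PowerSeries ℤ_[p]) (hF : IsLubinTate p F)
    (π : ℕ → ℂ_[p]) (hπ : IsTateGenerator F π)
    (φ : ℂ_[p] →+* ℂ_[p])
    (ℓ s : ℕ) (hℓ : 1 ≤ ℓ) (hs : 1 ≤ s)
    {k : Type*} [Field k] [Fintype k] (hk : Fintype.card k = p ^ s)
    (red : ringMu p s →+* k)
    (t : fieldMu p s) (ht : (t : ℂ_[p]) ∈ ringMu p s) (htq : t ^ p ^ s = t)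
    (htr : ¬ ∃ c : ℤ_[p], Algebra.trace ℚ_[p] (fieldMu p s) t = (p : ℚ_[p]) * (c : ℚ_[p])) :
    IsSplittingFunction red ℓ (ringO F ⊔ ringMu p s) (Omega φ π ℓ s t) ∧
      ((t : ℂ_[p]) ∈ (ofPadicInt p).range →
        IsSplittingFunction red ℓ (ringO F) (Omega φ π ℓ s t)) := by
  have ht0 : (⟨t, ht⟩ : ringMu p s) ≠ 0 := by
    intro h
    have h0 : t = 0 :=
      Subtype.coe_injective (congrArg (Subtype.val : ringMu p s → ℂ_[p]) h)
    exact htr ⟨0, by rw [h0, map_zero, PadicInt.coe_zero, mul_zero]⟩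
  have htq' : (⟨t, ht⟩ : ringMu p s) ^ p ^ s = ⟨t, ht⟩ :=
    Subtype.coe_injective (congrArg (Subtype.val : fieldMu p s → ℂ_[p]) htq)
  exact ⟨isSplittingFunction_Omega hk hs red hF hπ φ hℓ htq' ht0 le_sup_left
      ((le_sup_right : ringMu p s ≤ _) ht),
    fun h => isSplittingFunction_Omega hk hs red hF hπ φ hℓ htq' ht0 le_rfl
      (range_ofPadicInt_le_ringO h)⟩
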